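/- Let $\mu$ be a Borel probability measure on the unit circle $\mathbb T$ with infinite support, and put $\langle f,g\rangle_\mu=\int_{\mathbb T} f\,\overline{g}\,d\mu$. Let $\rho_0,\rho_1,\dots$ be the monic polynomials obtained by applying Gram–Schmidt to $1,z,z^2,\dots$ (the Szegő polynomials), let $\delta_n=\rho_n(0)$ be the Schur parameters, so that $\delta_0=1$ and $|\delta_n|<1$ for $n\ge 1$, and let $\eta_n=\sqrt{1-|\delta_n|^2}$. Let $\chi_0,\chi_1,\dots$ be the orthonormal Laurent polynomials, with positive leading coefficients, obtained by applying Gram–Schmidt to $1,z,z^{-1},z^2,z^{-2},\dots$ (the balanced ordering $p(n)=\lfloor n/2\rfloor$). Let $\mathcal C(\delta)$ be the infinite five-diagonal CMV matrix, with rows and columns indexed from $0$, whose only nonzero entries are the following. Row $0$ is $(-\delta_1,\eta_1,0,\dots)$. For $k\ge1$, row $2k-1$ has the entries $-\eta_{2k-1}\delta_{2k},\ -\overline{\delta_{2k-1}}\delta_{2k},\ -\eta_{2k}\delta_{2k+1},\ \eta_{2k}\eta_{2k+1}$ and row $2k$ has the entries $\eta_{2k-1}\eta_{2k},\ \overline{\delta_{2k-1}}\eta_{2k},\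 -\overline{\delta_{2k}}\delta_{2k+1},\ \overline{\delta_{2k}}\eta_{2k+1}$, in both cases in the columns $2k-2,2k-1,2k,2k+1$. For $n\ge1$ and $u\in\mathbb T$ let $\mathcal C_n(\delta_1,\dots,\delta_{n-1},u)$ be the principal submatrix of order $n$ of $\mathcal C(\delta)$ in which $\delta_n$ is replaced by $u$. Let $$R_n(z,u)=\eta_n\chi_n(z)+\tau_n\chi_{n-1}(z),\qquad \tau_n=\begin{cases}u-\delta_n,& n\text{ odd},\\ \overline{u-\delta_n},& n\text{ even}.\end{cases}$$ An $n$-point Szegő quadrature formula for $\mu$ with parameter $u$ is a formula $I_n(f)=\sum_{j=1}^n\lambda_j f(z_j)$ with complex weights $\lambda_j$, whose nodes $z_1,\dots,z_n\in\mathbb T$ are distinct and are precisely the zeros of $R_n(\cdot,u)$ in $\mathbb C\setminus\{0\}$, and which satisfies $I_n(L)=\int_{\mathbb T} L\,d\mu$ for all $L\in\operatorname{span}\{z^k:-(n-1)\le k\le n-1\}$. Theorem. Let $n\ge 1$ and $u\in\mathbb T$. An $n$-point Szegő quadrature formula for $\mu$ with parameter $u$ and with positive weights exists. Moreover, for every $n$-point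 Szegő quadrature formula $\sum_{j=1}^n\lambda_jf(z_j)$ for $\mu$ with parameter $u$: 1. the nodes $z_1,\dots,z_n$ are exactly the eigenvalues of $\mathcal C_n(\delta_1,\dots,\delta_{n-1},u)$; 2. for every $j$ and every eigenvector $v=(v_0,\dots,v_{n-1})^T$ of $\mathcal C_n(\delta_1,\dots,\delta_{n-1},u)$ for the eigenvalue $z_j$ with $\sum_i|v_i|^2=1$, one has $\lambda_j=|v_0|^2$. -/

import Mathlib

open MeasureTheory
open scoped ComplexConjugate

namespace SzegoCMV

/-- The unit circle carries its Borel σ-algebra. -/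
noncomputable instance : MeasurableSpace Circle := borel Circle

instance : BorelSpace Circle := ⟨rfl⟩

/-- Complex Laurent polynomials `ℂ[z, z⁻¹]`. -/
abbrev Laurent : Type := LaurentPolynomial ℂ

/-- The value `L(x)` of a Laurent polynomial at a nonzero complex number `x`. -/
noncomputable def ev (L : Laurent) (x : ℂˣ) : ℂ :=
  LaurentPolynomial.eval₂ (RingHom.id ℂ) x L

/-- The value `L(w)` at a point `w` of the unit circle. -/
noncomputable def evC (L : Laurent) (w : Circle) : ℂ :=
  ev L (Circle.toUnits w)

/-- The space `Λ_{a,b} = span {z^a, z^(a+1), …, z^b}`. -/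
noncomputable def LaurentSpan (a b : ℤ) : Submodule ℂ Laurent :=
  Submodule.span ℂ {L | ∃ k : ℤ, a ≤ k ∧ k ≤ b ∧ L = LaurentPolynomial.T k}

/-- The inner product `⟨f, g⟩_μ = ∫ f(w) conj(g(w)) dμ(w)`, linear in the first variable. -/
noncomputable def ip (μ : Measure Circle) (f g : Laurent) : ℂ :=
  ∫ w, evC f w * conj (evC g w) ∂μ

/-- `s(n) = p(n) - p(n-1)`, with the convention `p(-1) = 0`, for a generating sequence `p`
(so `p 0 = 0` and `p n - p (n - 1) ∈ {0, 1}`); the natural subtraction is exact there. -/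
def step (p : ℕ → ℕ) (n : ℕ) : ℕ := p n - p (n - 1)

/-- The monomial adjoined at the `n`-th stage of the ordering of `ℂ[z, z⁻¹]` induced by `p`:
`z^q(n)` with `q(n) = n - p(n)` if `s(n) = 0`, and `z^(-p(n))` if `s(n) = 1`. -/
noncomputable def newMonomial (p : ℕ → ℕ) (n : ℕ) : Laurent :=
  if step p n = 0 then LaurentPolynomial.T ((n : ℤ) - (p n : ℤ))
  else LaurentPolynomial.T (-(p n : ℤ))

/-- The monic orthogonal Laurent polynomials for the measure `μ` and the ordering induced by `p`:
the Gram-Schmidt process applied to the monomials `newMonomial p 0, newMonomial p 1, …`. -/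
noncomputable def monicOLP (μ : Measure Circle) (p : ℕ → ℕ) (n : ℕ) : Laurent :=
  newMonomial p n - ∑ k : Fin n,
    LaurentPolynomial.C
        (ip μ (newMonomial p n) (monicOLP μ p k) / ip μ (monicOLP μ p k) (monicOLP μ p k)) *
      monicOLP μ p k
termination_by n
decreasing_by all_goals exact k.2

/-- The orthonormal Laurent polynomials (with positive leading coefficients) for the measure `μ`
and the ordering induced by `p`. -/
noncomputable def orthonormalOLP (μ : Measure Circle) (p : ℕ → ℕ) (n : ℕ) : Laurent :=
  LaurentPolynomial.C (((Real.sqrt (ip μ (monicOLP μ p n) (monicOLP μ p n)).re)⁻¹ : ℝ) : ℂ) *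
    monicOLP μ p n

/-- The monic Szegő polynomials: the case `p = 0`, where `z^0, z^1, z^2, …` are orthogonalized. -/
noncomputable def szegoPoly (μ : Measure Circle) (n : ℕ) : Laurent :=
  monicOLP μ (fun _ => 0) n

/-- The Schur parameters `δ_n = ρ_n(0)`, i.e. the constant coefficient of the `n`-th monic Szegő
polynomial. For `n = 0` this is `δ_0 = 1`. -/
noncomputable def schur (μ : Measure Circle) (n : ℕ) : ℂ :=
  (szegoPoly μ n).coeff 0

/-- `η_n = √(1 - |δ_n|²)`. -/
noncomputable def eta (δ : ℕ → ℂ) (n : ℕ) : ℂ :=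
  ((Real.sqrt (1 - ‖δ n‖ ^ 2) : ℝ) : ℂ)

/-- The infinite five-diagonal CMV matrix `C(δ)`, rows and columns numbered from `0`:
row `0` is `(-δ₁, η₁, 0, …)`; an odd row `i` has the entries
`-η_i δ_{i+1}, -conj(δ_i) δ_{i+1}, -η_{i+1} δ_{i+2}, η_{i+1} η_{i+2}` in the columns
`i-1, i, i+1, i+2`; an even row `i ≥ 2` has the entries
`η_{i-1} η_i, conj(δ_{i-1}) η_i, -conj(δ_i) δ_{i+1}, conj(δ_i) η_{i+1}` in the columns
`i-2, i-1, i, i+1`. -/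
noncomputable def cmv (δ : ℕ → ℂ) : Matrix ℕ ℕ ℂ := fun i j =>
  if i = 0 then
    if j = 0 then -δ 1
    else if j = 1 then eta δ 1
    else 0
  else if Odd i then
    if j + 1 = i then -(eta δ i * δ (i + 1))
    else if j = i then -(conj (δ i) * δ (i + 1))
    else if j = i + 1 then -(eta δ (i + 1) * δ (i + 2))
    else if j = i + 2 then eta δ (i + 1) * eta δ (i + 2)
    else 0
  else
    if j + 2 = i then eta δ (i - 1) * eta δ i
    else if j + 1 = i then conj (δ (i - 1)) * eta δ i
    else if j = i then -(conj (δ i) * δ (i + 1))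
    else if j = i + 1 then conj (δ i) * eta δ (i + 1)
    else 0

/-- `C_n(δ_1, …, δ_{n-1}, u)`: the principal submatrix of order `n` of the CMV matrix, in which
the parameter `δ_n` is replaced by `u`. -/
noncomputable def cmvTrunc (δ : ℕ → ℂ) (n : ℕ) (u : ℂ) : Matrix (Fin n) (Fin n) ℂ :=
  (cmv (Function.update δ n u)).submatrix (fun i => (i : ℕ)) (fun j => (j : ℕ))

/-- The balanced generating sequence `p(n) = ⌊n / 2⌋`. -/
def balanced (n : ℕ) : ℕ := n / 2

/-- The coefficient `τ_n` : `u - δ_n` if `s(n) = 0`, and its conjugate if `s(n) = 1`. -/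
noncomputable def tau (μ : Measure Circle) (p : ℕ → ℕ) (n : ℕ) (u : Circle) : ℂ :=
  if step p n = 0 then (u : ℂ) - schur μ n else conj ((u : ℂ) - schur μ n)

/-- The nodal Laurent polynomial `R_n(z, u) = η_n χ_n(z) + τ_n χ_{n-1}(z)` (`n ≥ 1`), with `χ` the
orthonormal Laurent polynomials of the balanced ordering. -/
noncomputable def nodal (μ : Measure Circle) (n : ℕ) (u : Circle) : Laurent :=
  LaurentPolynomial.C (eta (schur μ) n) * orthonormalOLP μ balanced n +
    LaurentPolynomial.C (tau μ balanced n u) * orthonormalOLP μ balanced (n - 1)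

/-- `I_n(f) = ∑ j, lam j * f (z j)` is the `n`-point Szegő quadrature formula for `μ` with
parameter `u`: its nodes are distinct points of the unit circle and are precisely the zeros of
`R_n(z, u)` in `ℂ ∖ {0}`, and it integrates exactly every element of `Λ_{-(n-1), n-1}`. -/
structure IsSzegoQuadrature (μ : Measure Circle) (n : ℕ) (u : Circle)
    (z : Fin n → Circle) (lam : Fin n → ℂ) : Prop where
  distinct : Function.Injective z
  nodes : ∀ x : ℂˣ, ev (nodal μ n u) x = 0 ↔ ∃ j, Circle.toUnits (z j) = x
  exact_on : ∀ L ∈ LaurentSpan (-((n : ℤ) - 1)) ((n : ℤ) - 1),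
    ∑ j, lam j * evC L (z j) = ∫ w, evC L w ∂μ

end SzegoCMV

namespace SzegoCMV

open LaurentPolynomial

section Laurent

/-! ### Coefficients, reflection and evaluation -/

/-! On the circle, conjugation of values is the ring involution `reflect`, so every inner product is
a moment of a Laurent polynomial. The balanced `χ_n` are shifted Szegő polynomials or their
reversals, and the Szegő recursion becomes a first-order antilinear one: `η_n χ_n = z χ̃_{n-1} + δ_n
χ_{n-1}` for odd `n`, and `η_n χ_n = χ̃_{n-1} + conj(δ_n) χ_{n-1}` for even `n`, where `χ̃` is the
reflection of `χ`. Hence `R_n` is the right side with `δ_n` replaced by `u`.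

Since `|u| = 1`, the parameter `u` makes `η_n` vanish. A zero `w` of `R_n` is thus a point where the
recursion with `δ_n = u` closes up with zeros from index `n` on. Composing consecutive steps gives
the rows of the CMV matrix, so the vector of values `χ_i(w)`, `i < n`, is an eigenvector for `w`
(`sum_cmv_mul`, `cmvTrunc_mulVec`).

Let `V = (χ_i(z_j))`. Exactness applied to `χ_i χ̃_k` gives `V Λ V* = 1` with `Λ = diag(λ_j)`. So
`V` is invertible and diagonalizes the truncated matrix, every eigenvector is a multiple of a
column, and the diagonal of `Λ V* V = 1` reads `λ_j ∑_i |χ_i(z_j)|² = 1`. As `χ_0 = 1`, a unit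
eigenvector has `|v_0|² = λ_j`.

For existence, `R_n` is orthogonal to a Laurent space of dimension `n - 1` and is self-reciprocal. A
pair of zeros symmetric in the circle, or a double zero on it, would contradict definiteness
(`not_mul_dvd_nodal`), so there are `n` simple zeros on the circle. Interpolatory weights are then
exact (`exists_weights`), and the identity for `λ_j` forces positivity. -/

lemma coeff_mul_T (f : Laurent) (m k : ℤ) : (f * T m).coeff k = f.coeff (k - m) := by
  rw [T, AddMonoidAlgebra.coeff_mul_single_eq_coeff_mul (k - m)
    (fun a _ => by constructor <;> intro h <;> omega), mul_one]

lemma coeff_C_mul (a : ℂ) (f : Laurent) (k : ℤ) : (C a * f).coeff k = a * f.coeff k := by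
  simp [← smul_eq_C_mul]

/-- The conjugate-linear involution `∑ aₖ z^k ↦ ∑ conj(aₖ) z^(-k)`, which is pointwise complex
conjugation on the unit circle. -/
noncomputable def reflect : Laurent →+* Laurent :=
  (invert (R := ℂ)).toAlgHom.toRingHom.comp (AddMonoidAlgebra.mapRingHom ℤ (starRingEnd ℂ))

@[simp] lemma coeff_reflect (f : Laurent) (k : ℤ) :
    (reflect f).coeff k = conj (f.coeff (-k)) := by
  simp [reflect]

@[simp] lemma reflect_T (k : ℤ) : reflect (T k) = T (-k) := by
  ext j
  rw [coeff_reflect, T_apply, T_apply]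
  split_ifs <;> first | omega | simp

@[simp] lemma reflect_C (a : ℂ) : reflect (C a) = C (conj a) := by
  ext j
  rw [coeff_reflect, C_apply, C_apply]
  split_ifs <;> first | omega | simp

@[simp] lemma reflect_reflect (f : Laurent) : reflect (reflect f) = f := by
  ext j; simp

lemma ev_add (f g : Laurent) (x : ℂˣ) : ev (f + g) x = ev f x + ev g x := map_add _ _ _
lemma ev_mul (f g : Laurent) (x : ℂˣ) : ev (f * g) x = ev f x * ev g x := map_mul _ _ _
@[simp] lemma ev_C (a : ℂ) (x : ℂˣ) : ev (C a) x = a := by simp [ev]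
@[simp] lemma ev_T (k : ℤ) (x : ℂˣ) : ev (T k) x = (x : ℂ) ^ k := by simp [ev]
lemma ev_toLaurent (P : Polynomial ℂ) (x : ℂˣ) :
    ev (Polynomial.toLaurent P) x = P.eval (x : ℂ) := by
  simp [ev]

lemma evC_add (f g : Laurent) (w : Circle) : evC (f + g) w = evC f w + evC g w := ev_add _ _ _
lemma evC_mul (f g : Laurent) (w : Circle) : evC (f * g) w = evC f w * evC g w := ev_mul _ _ _
@[simp] lemma evC_C (a : ℂ) (w : Circle) : evC (C a) w = a := ev_C _ _
@[simp] lemma evC_T (k : ℤ) (w : Circle) : evC (T k) w = (w : ℂ) ^ k := by simp [evC]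
lemma evC_toLaurent (P : Polynomial ℂ) (w : Circle) :
    evC (Polynomial.toLaurent P) w = P.eval (w : ℂ) := by simp [evC, ev_toLaurent]

lemma evC_reflect (f : Laurent) (w : Circle) : evC (reflect f) w = conj (evC f w) := by
  induction f using LaurentPolynomial.induction_on' with
  | add p q hp hq => simp [map_add, evC_add, hp, hq]
  | C_mul_T k a => simp [evC_mul, ← Circle.coe_inv_eq_conj]

lemma continuous_evC (f : Laurent) : Continuous (evC f) := by
  induction f using LaurentPolynomial.induction_on' with
  | add p q hp hq => rw [funext (evC_add p q)]; exact hp.add hq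
  | C_mul_T k a =>
    have : evC (C a * T k) = fun w : Circle => a * (((w ^ k : Circle)) : ℂ) := by
      funext w; simp [evC_mul]
    rw [this]
    exact continuous_const.mul (continuous_induced_dom.comp (continuous_zpow k))

lemma exists_toLaurent_mul_T (f : Laurent) :
    ∃ (P : Polynomial ℂ) (m : ℤ), f = Polynomial.toLaurent P * T m := by
  obtain ⟨n, P, hP⟩ := f.exists_T_pow
  exact ⟨P, -n, by rw [hP, mul_T_assoc]; simp⟩

lemma finite_zeros_evC {f : Laurent} (hf : f ≠ 0) : {w : Circle | evC f w = 0}.Finite := by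
  obtain ⟨P, m, rfl⟩ := exists_toLaurent_mul_T f
  have hP : P ≠ 0 := by rintro rfl; simp at hf
  refine Set.Finite.of_finite_image (f := fun w : Circle => (w : ℂ))
    (P.roots.toFinset.finite_toSet.subset ?_) Circle.coe_injective.injOn
  rintro _ ⟨w, hw, rfl⟩
  simp only [Set.mem_ofPred_eq, evC_mul, evC_toLaurent, evC_T, mul_eq_zero] at hw
  have : (w : ℂ) ^ m ≠ 0 := zpow_ne_zero _ (Circle.coe_ne_zero w)
  simp [hP, Polynomial.IsRoot, hw.resolve_right this]

/-! ### The spaces `Λ_{a,b}` -/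

lemma T_mem_LaurentSpan {a b k : ℤ} (h₁ : a ≤ k) (h₂ : k ≤ b) : T k ∈ LaurentSpan a b :=
  Submodule.subset_span ⟨k, h₁, h₂, rfl⟩

lemma mem_LaurentSpan_iff {a b : ℤ} {f : Laurent} :
    f ∈ LaurentSpan a b ↔ ∀ k, (k < a ∨ b < k) → f.coeff k = 0 := by
  constructor
  · intro hf k hk
    induction hf using Submodule.span_induction with
    | mem x hx =>
      obtain ⟨j, h1, h2, rfl⟩ := hx
      rw [T_apply, if_neg (by omega)]
    | zero => simp
    | add x y _ _ hx hy => simp [hx, hy]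
    | smul c x _ hx => simp [hx]
  · intro h
    rw [← AddMonoidAlgebra.sum_coeff_single f]
    refine Submodule.sum_mem _ fun k hk => ?_
    have hk' : a ≤ k ∧ k ≤ b := by
      by_contra hc
      exact (Finsupp.mem_support_iff.1 hk) (h k (by omega))
    rw [single_eq_C_mul_T, ← smul_eq_C_mul]
    exact Submodule.smul_mem _ _ (T_mem_LaurentSpan hk'.1 hk'.2)

lemma coeff_eq_zero_of_mem {a b : ℤ} {f : Laurent} (hf : f ∈ LaurentSpan a b) {k : ℤ}
    (hk : k < a ∨ b < k) : f.coeff k = 0 := mem_LaurentSpan_iff.1 hf k hk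

lemma LaurentSpan_mono {a b a' b' : ℤ} (ha : a' ≤ a) (hb : b ≤ b') :
    LaurentSpan a b ≤ LaurentSpan a' b' := fun _ hf =>
  mem_LaurentSpan_iff.2 fun _ hk => coeff_eq_zero_of_mem hf (by omega)

lemma mul_T_mem {a b : ℤ} {f : Laurent} (hf : f ∈ LaurentSpan a b) (m : ℤ) :
    f * T m ∈ LaurentSpan (a + m) (b + m) :=
  mem_LaurentSpan_iff.2 fun _ hk => by rw [coeff_mul_T]; exact coeff_eq_zero_of_mem hf (by omega)

lemma reflect_mem {a b : ℤ} {f : Laurent} (hf : f ∈ LaurentSpan a b) :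
    reflect f ∈ LaurentSpan (-b) (-a) :=
  mem_LaurentSpan_iff.2 fun _ hk => by
    rw [coeff_reflect, coeff_eq_zero_of_mem hf (by omega), map_zero]

lemma C_mul_mem {W : Submodule ℂ Laurent} {f : Laurent} (hf : f ∈ W) (c : ℂ) : C c * f ∈ W := by
  rw [← smul_eq_C_mul]; exact W.smul_mem _ hf

lemma mul_mem_LaurentSpan {a b a' b' : ℤ} {f g : Laurent} (hf : f ∈ LaurentSpan a b)
    (hg : g ∈ LaurentSpan a' b') : f * g ∈ LaurentSpan (a + a') (b + b') := by
  induction hg using Submodule.span_induction with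
  | mem x hx =>
    obtain ⟨j, h1, h2, rfl⟩ := hx
    exact LaurentSpan_mono (by omega) (by omega) (mul_T_mem hf j)
  | zero => simp
  | add x y _ _ hx hy => rw [mul_add]; exact add_mem hx hy
  | smul c x _ hx => rw [mul_smul_comm]; exact Submodule.smul_mem _ _ hx

lemma toLaurent_mem_LaurentSpan {P : Polynomial ℂ} {d : ℤ} (h : (P.natDegree : ℤ) ≤ d) :
    Polynomial.toLaurent P ∈ LaurentSpan 0 d := by
  rw [P.as_sum_range_C_mul_X_pow, map_sum]
  refine Submodule.sum_mem _ fun k hk => ?_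
  rw [Polynomial.toLaurent_C_mul_X_pow]
  have := Finset.mem_range.1 hk
  exact C_mul_mem (T_mem_LaurentSpan (by omega) (by omega)) _

lemma exists_toLaurent_eq {f : Laurent} {d : ℕ} (hf : f ∈ LaurentSpan 0 d) :
    ∃ P : Polynomial ℂ, P.natDegree ≤ d ∧ Polynomial.toLaurent P = f := by
  induction hf using Submodule.span_induction with
  | mem x hx =>
    obtain ⟨j, h1, h2, rfl⟩ := hx
    lift j to ℕ using h1
    exact ⟨Polynomial.X ^ j, (Polynomial.natDegree_X_pow_le j).trans (by omega), by simp⟩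
  | zero => exact ⟨0, by simp, by simp⟩
  | add x y _ _ hx hy =>
    obtain ⟨P, hP, rfl⟩ := hx
    obtain ⟨Q, hQ, rfl⟩ := hy
    exact ⟨P + Q, Polynomial.natDegree_add_le_of_degree_le hP hQ, map_add _ _ _⟩
  | smul c x _ hx =>
    obtain ⟨P, hP, rfl⟩ := hx
    exact ⟨Polynomial.C c * P, (Polynomial.natDegree_C_mul_le c P).trans hP,
      by rw [smul_eq_C_mul]; simp⟩

lemma coeff_toLaurent_natCast (P : Polynomial ℂ) (k : ℕ) :
    (Polynomial.toLaurent P).coeff (k : ℤ) = P.coeff k := by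
  induction P using Polynomial.induction_on' with
  | add p q hp hq => simp only [map_add, AddMonoidAlgebra.coeff_add, Finsupp.add_apply, hp, hq,
      Polynomial.coeff_add]
  | monomial n a =>
    rw [Polynomial.toLaurent_C_mul_T, coeff_C_mul, T_apply, Polynomial.coeff_monomial]
    simp

/-! ### The moment functional and the inner product -/

variable {μ : Measure Circle}

lemma ip_self (f : Laurent) : ip μ f f = ((∫ w, ‖evC f w‖ ^ 2 ∂μ : ℝ) : ℂ) := by
  simp only [ip, Complex.mul_conj, Complex.normSq_eq_norm_sq]
  exact integral_ofReal

variable [IsProbabilityMeasure μ]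

lemma integrable_of_continuous {f : Circle → ℂ} (hf : Continuous f) : Integrable f μ := by
  obtain ⟨B, hB⟩ := isCompact_univ.exists_bound_of_continuousOn hf.continuousOn
  exact Integrable.of_bound hf.aestronglyMeasurable B
    (Filter.Eventually.of_forall fun x => hB x (Set.mem_univ x))

variable (μ) in
/-- The moment functional `f ↦ ∫ f dμ`. -/
noncomputable def moment : Laurent →ₗ[ℂ] ℂ where
  toFun f := ∫ w, evC f w ∂μ
  map_add' f g := by
    simp only [evC_add]
    exact integral_add (integrable_of_continuous (continuous_evC f))
      (integrable_of_continuous (continuous_evC g))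
  map_smul' c f := by
    simp only [smul_eq_C_mul, evC_mul, evC_C, RingHom.id_apply, smul_eq_mul]
    exact integral_const_mul c _

lemma ip_eq_moment (f g : Laurent) : ip μ f g = moment μ (f * reflect g) := by
  simp [ip, moment, evC_mul, evC_reflect]

lemma moment_reflect (f : Laurent) : moment μ (reflect f) = conj (moment μ f) := by
  simp only [moment, LinearMap.coe_mk, AddHom.coe_mk, evC_reflect]
  exact integral_conj

lemma moment_C_mul (c : ℂ) (f : Laurent) : moment μ (C c * f) = c * moment μ f := by
  rw [← smul_eq_C_mul, map_smul, smul_eq_mul]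

lemma ip_add_left (f g h : Laurent) : ip μ (f + g) h = ip μ f h + ip μ g h := by
  simp [ip_eq_moment, add_mul]

lemma ip_sub_left (f g h : Laurent) : ip μ (f - g) h = ip μ f h - ip μ g h := by
  simp [ip_eq_moment, sub_mul]

lemma ip_C_mul_left (c : ℂ) (f g : Laurent) : ip μ (C c * f) g = c * ip μ f g := by
  rw [ip_eq_moment, ip_eq_moment, mul_assoc, moment_C_mul]

lemma ip_sum_left {ι : Type*} (s : Finset ι) (f : ι → Laurent) (g : Laurent) :
    ip μ (∑ i ∈ s, f i) g = ∑ i ∈ s, ip μ (f i) g := by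
  simp [ip_eq_moment, Finset.sum_mul]

lemma ip_conj_symm (f g : Laurent) : conj (ip μ f g) = ip μ g f := by
  rw [ip_eq_moment, ip_eq_moment, ← moment_reflect, map_mul, reflect_reflect, mul_comm]

lemma ip_add_right (f g h : Laurent) : ip μ f (g + h) = ip μ f g + ip μ f h := by
  simp [ip_eq_moment, mul_add]

lemma ip_C_mul_right (c : ℂ) (f g : Laurent) : ip μ f (C c * g) = conj c * ip μ f g := by
  rw [← ip_conj_symm, ip_C_mul_left, map_mul, ip_conj_symm]

lemma ip_zero_right (f : Laurent) : ip μ f 0 = 0 := by simp [ip_eq_moment]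

lemma ip_eq_zero_symm {f g : Laurent} (h : ip μ f g = 0) : ip μ g f = 0 := by
  rw [← ip_conj_symm, h, map_zero]

lemma ip_mul_T_mul_T (f g : Laurent) (m : ℤ) : ip μ (f * T m) (g * T m) = ip μ f g := by
  rw [ip_eq_moment, ip_eq_moment, map_mul reflect, reflect_T, mul_mul_mul_comm, ← T_add]
  simp

lemma ip_reflect_reflect (f g : Laurent) : ip μ (reflect f) (reflect g) = ip μ g f := by
  rw [ip_eq_moment, ip_eq_moment, reflect_reflect, mul_comm]

/-- Orthogonality to a submodule may be tested on a spanning set. -/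
lemma ip_eq_zero_of_mem_span {f g : Laurent} {s : Set Laurent}
    (h : ∀ x ∈ s, ip μ f x = 0) (hg : g ∈ Submodule.span ℂ s) : ip μ f g = 0 := by
  induction hg using Submodule.span_induction with
  | mem x hx => exact h x hx
  | zero => exact ip_zero_right f
  | add x y _ _ hx hy => rw [ip_add_right, hx, hy, add_zero]
  | smul c x _ hx => rw [smul_eq_C_mul, ip_C_mul_right, hx, mul_zero]

/-- If the integral vanished, the closed zero set of `f` would have full measure and so contain the
support, but a nonzero Laurent polynomial has only finitely many zeros. This is where infinite
support enters. -/
lemma integral_norm_sq_pos (hμ : μ.support.Infinite) {f : Laurent} (hf : f ≠ 0) :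
    0 < ∫ w, ‖evC f w‖ ^ 2 ∂μ := by
  have hc : Continuous fun w => ‖evC f w‖ ^ 2 := (continuous_evC f).norm.pow 2
  have hi : Integrable (fun w => ‖evC f w‖ ^ 2) μ :=
    (integrable_of_continuous (μ := μ) (Complex.continuous_ofReal.comp hc)).re
  refine lt_of_le_of_ne (integral_nonneg fun w => by positivity) fun h0 => ?_
  have hae := (integral_eq_zero_iff_of_nonneg (fun w => by positivity) hi).1 h0.symm
  refine hμ ((finite_zeros_evC hf).subset
    (Measure.support_subset_of_isClosed (isClosed_eq (continuous_evC f) continuous_const) ?_))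
  filter_upwards [hae] with w hw
  simpa using hw

lemma ip_self_eq_zero (hμ : μ.support.Infinite) {f : Laurent} (h : ip μ f f = 0) : f = 0 := by
  by_contra hf
  have := integral_norm_sq_pos hμ hf
  rw [ip_self, Complex.ofReal_eq_zero] at h
  exact this.ne' h

end Laurent

section GramSchmidt

/-! ### The Gram-Schmidt process -/

/-- The span of the monomials adjoined before the `n`-th stage. -/
noncomputable def priorSpan (p : ℕ → ℕ) (n : ℕ) : Submodule ℂ Laurent :=
  Submodule.span ℂ {L | ∃ k < n, L = newMonomial p k}

lemma priorSpan_mono (p : ℕ → ℕ) {m n : ℕ} (h : m ≤ n) : priorSpan p m ≤ priorSpan p n :=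
  Submodule.span_mono fun _ ⟨k, hk, e⟩ => ⟨k, hk.trans_le h, e⟩

lemma monicOLP_sub_mem (μ : Measure Circle) (p : ℕ → ℕ) (n : ℕ) :
    monicOLP μ p n - newMonomial p n ∈ priorSpan p n := by
  induction n using Nat.strong_induction_on with
  | _ n ih =>
    rw [monicOLP, sub_sub_cancel_left]
    refine neg_mem (Submodule.sum_mem _ fun k _ => C_mul_mem ?_ _)
    have h1 := priorSpan_mono p k.2.le (ih k k.2)
    have h2 : newMonomial p k ∈ priorSpan p n := Submodule.subset_span ⟨k, k.2, rfl⟩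
    simpa using add_mem h1 h2

lemma monicOLP_mem (μ : Measure Circle) (p : ℕ → ℕ) {k n : ℕ} (h : k < n) :
    monicOLP μ p k ∈ priorSpan p n := by
  have h1 := priorSpan_mono p h.le (monicOLP_sub_mem μ p k)
  have h2 : newMonomial p k ∈ priorSpan p n := Submodule.subset_span ⟨k, h, rfl⟩
  simpa using add_mem h1 h2

lemma priorSpan_le_span_monicOLP (μ : Measure Circle) (p : ℕ → ℕ) (n : ℕ) :
    priorSpan p n ≤ Submodule.span ℂ {L | ∃ k < n, L = monicOLP μ p k} := by
  refine Submodule.span_le.2 ?_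
  rintro _ ⟨k, hk, rfl⟩
  have h := monicOLP.eq_1 μ p k
  have hmem (j : ℕ) (hj : j < n) :
      monicOLP μ p j ∈ Submodule.span ℂ {L | ∃ k < n, L = monicOLP μ p k} :=
    Submodule.subset_span ⟨j, hj, rfl⟩
  rw [eq_sub_iff_add_eq] at h
  rw [← h, SetLike.mem_coe]
  exact add_mem (hmem k hk) (Submodule.sum_mem _ fun j _ => C_mul_mem (hmem j (j.2.trans hk)) _)

/-- The squared norm of the `n`-th monic Szegő polynomial. -/
noncomputable def szegoNormSq (μ : Measure Circle) (n : ℕ) : ℝ :=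
  ∫ w, ‖evC (szegoPoly μ n) w‖ ^ 2 ∂μ

lemma ip_szegoPoly_self (μ : Measure Circle) (n : ℕ) :
    ip μ (szegoPoly μ n) (szegoPoly μ n) = szegoNormSq μ n :=
  ip_self _

variable {μ : Measure Circle} [IsProbabilityMeasure μ]

lemma ip_monicOLP_of_lt (hμ : μ.support.Infinite) (p : ℕ → ℕ) {n k : ℕ} (h : k < n) :
    ip μ (monicOLP μ p n) (monicOLP μ p k) = 0 := by
  induction n using Nat.strong_induction_on generalizing k with
  | _ n ih =>
    rw [monicOLP, ip_sub_left, ip_sum_left, Finset.sum_eq_single ⟨k, h⟩]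
    · rw [ip_C_mul_left]
      -- The Gram–Schmidt quotient has the default value `0` if its denominator vanishes.
      -- Definiteness makes the vector itself zero in that case, so the claim still holds.
      by_cases h0 : ip μ (monicOLP μ p k) (monicOLP μ p k) = 0
      · have := ip_self_eq_zero hμ h0
        simp [this, ip_zero_right]
      · field_simp
        simp
    · intro j _ hj
      rw [ip_C_mul_left]
      have hne : (j : ℕ) ≠ k := fun e => hj (Fin.ext e)
      rcases lt_or_gt_of_ne hne with hlt | hlt
      · rw [ip_eq_zero_symm (ih k h hlt), mul_zero]
      · rw [ih j j.2 hlt, mul_zero]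
    · simp

lemma ip_monicOLP_of_mem (hμ : μ.support.Infinite) (p : ℕ → ℕ) {n : ℕ} {f : Laurent}
    (hf : f ∈ priorSpan p n) : ip μ (monicOLP μ p n) f = 0 :=
  ip_eq_zero_of_mem_span (by rintro _ ⟨k, hk, rfl⟩; exact ip_monicOLP_of_lt hμ p hk)
    (priorSpan_le_span_monicOLP μ p n hf)

/-- The monic orthogonal Laurent polynomials are characterized by their leading monomial and
their orthogonality relations. -/
lemma eq_monicOLP (hμ : μ.support.Infinite) (p : ℕ → ℕ) {n : ℕ} {f : Laurent}
    (h₁ : f - newMonomial p n ∈ priorSpan p n)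
    (h₂ : ∀ g ∈ priorSpan p n, ip μ f g = 0) : f = monicOLP μ p n := by
  have hd : f - monicOLP μ p n ∈ priorSpan p n := by
    simpa using sub_mem h₁ (monicOLP_sub_mem μ p n)
  refine sub_eq_zero.1 (ip_self_eq_zero hμ ?_)
  rw [ip_sub_left, h₂ _ hd, ip_monicOLP_of_mem hμ p hd, sub_zero]

/-! ### The Szegő polynomials -/

lemma newMonomial_zero (n : ℕ) : newMonomial (fun _ => 0) n = T n := by
  simp [newMonomial, step]

lemma priorSpan_zero (n : ℕ) : priorSpan (fun _ => 0) n = LaurentSpan 0 (n - 1) := by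
  unfold priorSpan LaurentSpan
  congr 1
  ext L
  constructor
  · rintro ⟨k, hk, rfl⟩
    exact ⟨k, by omega, by omega, newMonomial_zero k⟩
  · rintro ⟨k, h1, h2, rfl⟩
    lift k to ℕ using h1
    exact ⟨k, by omega, (newMonomial_zero k).symm⟩

lemma szegoPoly_sub_mem (μ : Measure Circle) (n : ℕ) :
    szegoPoly μ n - T n ∈ LaurentSpan 0 (n - 1) := by
  have := monicOLP_sub_mem μ (fun _ => 0) n
  rwa [priorSpan_zero, newMonomial_zero] at this

lemma szegoPoly_mem (μ : Measure Circle) (n : ℕ) : szegoPoly μ n ∈ LaurentSpan 0 n := by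
  have := add_mem (LaurentSpan_mono le_rfl (by omega) (szegoPoly_sub_mem μ n))
    (T_mem_LaurentSpan (a := 0) (b := n) (by omega) le_rfl)
  simpa using this

lemma coeff_szegoPoly_self (μ : Measure Circle) (n : ℕ) : (szegoPoly μ n).coeff n = 1 := by
  have := coeff_eq_zero_of_mem (szegoPoly_sub_mem μ n) (k := n) (by omega)
  simpa [sub_eq_zero] using this

lemma szegoPoly_ne_zero (μ : Measure Circle) (n : ℕ) : szegoPoly μ n ≠ 0 := fun h => by
  simpa [h] using coeff_szegoPoly_self μ n

lemma ip_szegoPoly (hμ : μ.support.Infinite) {n : ℕ} {f : Laurent}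
    (hf : f ∈ LaurentSpan 0 (n - 1)) : ip μ (szegoPoly μ n) f = 0 :=
  ip_monicOLP_of_mem hμ _ (by rwa [priorSpan_zero])

/-- The Szegő recursion `ρ_{n+1}(z) = z ρ_n(z) + δ_{n+1} ρ_n^*(z)`, where
`ρ_n^*(z) = z^n conj(ρ_n(1 / conj z))`. -/
lemma szegoPoly_succ (hμ : μ.support.Infinite) (n : ℕ) :
    szegoPoly μ (n + 1) =
      szegoPoly μ n * T 1 + C (schur μ (n + 1)) * (reflect (szegoPoly μ n) * T n) := by
  have hstar : ∀ g ∈ LaurentSpan 1 n, ip μ (reflect (szegoPoly μ n) * T n) g = 0 := by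
    intro g hg
    have : g = reflect (reflect g * T n) * T n := by
      rw [map_mul, reflect_reflect, reflect_T, mul_T_assoc]; simp
    rw [this, ip_mul_T_mul_T, ip_reflect_reflect]
    refine ip_eq_zero_symm (ip_szegoPoly hμ ?_)
    exact LaurentSpan_mono (by omega) (by omega) (mul_T_mem (reflect_mem hg) n)
  have hshift : ∀ g ∈ LaurentSpan 1 n, ip μ (szegoPoly μ n * T 1) g = 0 := by
    intro g hg
    have : g = g * T (-1) * T 1 := by rw [mul_T_assoc]; simp
    rw [this, ip_mul_T_mul_T]
    refine ip_szegoPoly hμ ?_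
    exact LaurentSpan_mono (by omega) (by omega) (mul_T_mem hg (-1))
  have hsucc : ∀ g ∈ LaurentSpan 1 n, ip μ (szegoPoly μ (n + 1)) g = 0 := fun g hg =>
    ip_szegoPoly hμ (LaurentSpan_mono (by omega) (by push_cast; omega) hg)
  -- The leading terms cancel, and so do the constant terms, because the reversed polynomial takes
  -- the value 1 at 0. The difference therefore lies in the space `Λ_{1,n}`, to which all three of
  -- its terms are orthogonal; it is orthogonal to itself.
  have hmem : szegoPoly μ (n + 1) - szegoPoly μ n * T 1 -
      C (schur μ (n + 1)) * (reflect (szegoPoly μ n) * T n) ∈ LaurentSpan 1 n := by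
    have h1 : szegoPoly μ (n + 1) - szegoPoly μ n * T 1 ∈ LaurentSpan 0 n := by
      have e : szegoPoly μ (n + 1) - szegoPoly μ n * T 1 =
          (szegoPoly μ (n + 1) - T ((n + 1 : ℕ) : ℤ)) - (szegoPoly μ n - T n) * T 1 := by
        rw [sub_mul, ← T_add]; push_cast; ring
      rw [e]
      exact sub_mem (LaurentSpan_mono (by omega) (by push_cast; omega) (szegoPoly_sub_mem μ (n + 1)))
        (LaurentSpan_mono (by omega) (by omega) (mul_T_mem (szegoPoly_sub_mem μ n) 1))
    have h2 : reflect (szegoPoly μ n) * T n ∈ LaurentSpan 0 n :=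
      LaurentSpan_mono (by omega) (by omega) (mul_T_mem (reflect_mem (szegoPoly_mem μ n)) n)
    have h3 := sub_mem h1 (C_mul_mem h2 (schur μ (n + 1)))
    refine mem_LaurentSpan_iff.2 fun k hk => ?_
    by_cases hk0 : k = 0
    · subst hk0
      have e1 : (szegoPoly μ n * T 1).coeff 0 = 0 := by
        rw [coeff_mul_T]; exact coeff_eq_zero_of_mem (szegoPoly_mem μ n) (by omega)
      have e2 : (reflect (szegoPoly μ n) * T n).coeff 0 = 1 := by
        rw [coeff_mul_T, coeff_reflect]; simp [coeff_szegoPoly_self]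
      rw [AddMonoidAlgebra.coeff_sub, AddMonoidAlgebra.coeff_sub, Finsupp.sub_apply,
        Finsupp.sub_apply, coeff_C_mul, e1, e2, schur]
      ring
    · exact coeff_eq_zero_of_mem h3 (by omega)
  have := ip_self_eq_zero hμ (f := szegoPoly μ (n + 1) - szegoPoly μ n * T 1 -
      C (schur μ (n + 1)) * (reflect (szegoPoly μ n) * T n)) (by
    rw [ip_sub_left, ip_sub_left, ip_C_mul_left, hsucc _ hmem, hshift _ hmem, hstar _ hmem]
    ring)
  rw [sub_sub, sub_eq_zero] at this
  exact this

lemma szegoNormSq_pos (hμ : μ.support.Infinite) (n : ℕ) : 0 < szegoNormSq μ n :=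
  integral_norm_sq_pos hμ (szegoPoly_ne_zero μ n)

/-- Pythagoras for `z ρ_n = ρ_{n+1} - δ_{n+1} ρ_n^*`: multiplication by `z` and reversal preserve
norms, and `ρ_n^*` has degree at most `n`, so it is orthogonal to `ρ_{n+1}`. -/
lemma szegoNormSq_succ (hμ : μ.support.Infinite) (n : ℕ) :
    szegoNormSq μ (n + 1) = (1 - ‖schur μ (n + 1)‖ ^ 2) * szegoNormSq μ n := by
  have h2 : reflect (szegoPoly μ n) * T n ∈ LaurentSpan 0 ((n + 1 : ℕ) - 1) :=
    LaurentSpan_mono (by omega) (by push_cast; omega)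
      (mul_T_mem (reflect_mem (szegoPoly_mem μ n)) n)
  have h3 := ip_szegoPoly hμ h2
  have hT : szegoPoly μ n * T 1 = szegoPoly μ (n + 1) +
      C (-schur μ (n + 1)) * (reflect (szegoPoly μ n) * T n) := by
    rw [szegoPoly_succ hμ n, map_neg]; ring
  have h4 := ip_mul_T_mul_T (μ := μ) (szegoPoly μ n) (szegoPoly μ n) 1
  rw [hT, ip_add_left, ip_add_right, ip_add_right, ip_C_mul_left, ip_C_mul_left, ip_C_mul_right,
    ip_C_mul_right, h3, ip_eq_zero_symm h3, ip_mul_T_mul_T, ip_reflect_reflect,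
    ip_szegoPoly_self, ip_szegoPoly_self] at h4
  have h5 : schur μ (n + 1) * conj (schur μ (n + 1)) = ((‖schur μ (n + 1)‖ ^ 2 : ℝ) : ℂ) := by
    rw [Complex.mul_conj, Complex.normSq_eq_norm_sq]
  have h6 : (szegoNormSq μ (n + 1) : ℂ) + ((‖schur μ (n + 1)‖ ^ 2 : ℝ) : ℂ) * szegoNormSq μ n =
      szegoNormSq μ n := by
    rw [← h5]; rw [map_neg] at h4; linear_combination h4
  have h7 : szegoNormSq μ (n + 1) + ‖schur μ (n + 1)‖ ^ 2 * szegoNormSq μ n = szegoNormSq μ n := by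
    exact_mod_cast h6
  linarith

lemma norm_schur_lt_one (hμ : μ.support.Infinite) (n : ℕ) : ‖schur μ (n + 1)‖ < 1 := by
  have h1 := szegoNormSq_pos hμ (n + 1)
  rw [szegoNormSq_succ hμ] at h1
  have h2 := pos_of_mul_pos_left h1 (szegoNormSq_pos hμ n).le
  nlinarith [norm_nonneg (schur μ (n + 1))]

lemma sqrt_szegoNormSq_succ (hμ : μ.support.Infinite) (n : ℕ) :
    ((√(szegoNormSq μ (n + 1)) : ℝ) : ℂ) = eta (schur μ) (n + 1) * (√(szegoNormSq μ n) : ℝ) := by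
  have h := norm_schur_lt_one hμ n
  rw [szegoNormSq_succ hμ, Real.sqrt_mul (by nlinarith [norm_nonneg (schur μ (n + 1))]), eta,
    Complex.ofReal_mul]

lemma eta_ne_zero {δ : ℕ → ℂ} {n : ℕ} (h : ‖δ n‖ < 1) : eta δ n ≠ 0 := by
  have : 0 < 1 - ‖δ n‖ ^ 2 := by nlinarith [norm_nonneg (δ n)]
  rw [eta, Complex.ofReal_ne_zero]
  exact (Real.sqrt_pos.2 this).ne'

lemma eta_mul_self {δ : ℕ → ℂ} {n : ℕ} (h : ‖δ n‖ ≤ 1) :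
    eta δ n * eta δ n = 1 - δ n * conj (δ n) := by
  have : 0 ≤ 1 - ‖δ n‖ ^ 2 := by nlinarith [norm_nonneg (δ n)]
  rw [eta, ← Complex.ofReal_mul, Real.mul_self_sqrt this, Complex.mul_conj,
    Complex.normSq_eq_norm_sq]
  push_cast; ring

@[simp] lemma conj_eta (δ : ℕ → ℂ) (n : ℕ) : conj (eta δ n) = eta δ n := Complex.conj_ofReal _

/-! ### The balanced ordering -/

lemma newMonomial_balanced_even (k : ℕ) : newMonomial balanced (2 * k) = T (-k) := by
  unfold newMonomial step balanced
  rcases k with _ | k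
  · simp
  · rw [if_neg (by omega), Nat.mul_div_cancel_left _ (by norm_num)]

lemma newMonomial_balanced_odd (k : ℕ) : newMonomial balanced (2 * k + 1) = T (k + 1) := by
  unfold newMonomial step balanced
  rw [if_pos (by omega)]
  congr 1
  omega

/-- Integer division rounds down, so for `n = 0` the range of exponents is `1 ≤ k ≤ 0` and the space
is zero, as it should be. -/
lemma priorSpan_balanced (n : ℕ) :
    priorSpan balanced n = LaurentSpan (-(((n : ℤ) - 1) / 2)) ((n : ℤ) / 2) := by
  unfold priorSpan LaurentSpan
  congr 1
  ext L
  constructor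
  · rintro ⟨k, hk, rfl⟩
    obtain ⟨m, rfl | rfl⟩ := Nat.even_or_odd' k
    · exact ⟨-m, by omega, by omega, newMonomial_balanced_even m⟩
    · exact ⟨m + 1, by omega, by omega, newMonomial_balanced_odd m⟩
  · rintro ⟨k, h1, h2, rfl⟩
    by_cases hk : 0 < k
    · obtain ⟨m, rfl⟩ : ∃ m : ℕ, k = m + 1 := ⟨(k - 1).toNat, by omega⟩
      exact ⟨2 * m + 1, by omega, (newMonomial_balanced_odd m).symm⟩
    · obtain ⟨m, rfl⟩ : ∃ m : ℕ, k = -m := ⟨(-k).toNat, by omega⟩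
      exact ⟨2 * m, by omega, (newMonomial_balanced_even m).symm⟩

/-- Multiplication by `z^k` is an isometry carrying `Λ_{-k,k}` to `Λ_{0,2k}`, so the orthogonality
relations are those of the Szegő polynomial. At even indices, a reflection comes first. -/
lemma monicOLP_balanced_odd (hμ : μ.support.Infinite) (k : ℕ) :
    monicOLP μ balanced (2 * k + 1) = szegoPoly μ (2 * k + 1) * T (-k) := by
  symm
  apply eq_monicOLP hμ
  · rw [newMonomial_balanced_odd, priorSpan_balanced]
    have := mul_T_mem (szegoPoly_sub_mem μ (2 * k + 1)) (-k)
    rw [sub_mul, ← T_add] at this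
    have e : ((2 * k + 1 : ℕ) : ℤ) + -k = k + 1 := by push_cast; ring
    rw [e] at this
    exact LaurentSpan_mono (by push_cast; omega) (by push_cast; omega) this
  · intro g hg
    rw [priorSpan_balanced] at hg
    have : g = g * T k * T (-k) := by rw [mul_T_assoc]; simp
    rw [this, ip_mul_T_mul_T]
    exact ip_szegoPoly hμ (LaurentSpan_mono (by push_cast; omega) (by push_cast; omega)
      (mul_T_mem hg k))

lemma monicOLP_balanced_even (hμ : μ.support.Infinite) (k : ℕ) :
    monicOLP μ balanced (2 * k) = reflect (szegoPoly μ (2 * k)) * T k := by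
  symm
  apply eq_monicOLP hμ
  · rw [newMonomial_balanced_even, priorSpan_balanced]
    have := mul_T_mem (reflect_mem (szegoPoly_sub_mem μ (2 * k))) k
    rw [map_sub, reflect_T, sub_mul, ← T_add] at this
    have e : -((2 * k : ℕ) : ℤ) + k = -k := by push_cast; ring
    rw [e] at this
    exact LaurentSpan_mono (by push_cast; omega) (by push_cast; omega) this
  · intro g hg
    rw [priorSpan_balanced] at hg
    have : g = reflect (reflect g * T k) * T k := by
      rw [map_mul, reflect_reflect, reflect_T, mul_T_assoc]; simp
    rw [this, ip_mul_T_mul_T, ip_reflect_reflect]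
    exact ip_eq_zero_symm (ip_szegoPoly hμ (LaurentSpan_mono (by push_cast; omega)
      (by push_cast; omega) (mul_T_mem (reflect_mem hg) k)))

lemma ip_monicOLP_balanced_self (hμ : μ.support.Infinite) (n : ℕ) :
    ip μ (monicOLP μ balanced n) (monicOLP μ balanced n) = szegoNormSq μ n := by
  obtain ⟨k, rfl | rfl⟩ := Nat.even_or_odd' n
  · rw [monicOLP_balanced_even hμ, ip_mul_T_mul_T, ip_reflect_reflect, ip_szegoPoly_self]
  · rw [monicOLP_balanced_odd hμ, ip_mul_T_mul_T, ip_szegoPoly_self]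

end GramSchmidt

section Balanced

variable {μ : Measure Circle} [IsProbabilityMeasure μ]

/-! ### The orthonormal Laurent polynomials of the balanced ordering -/

lemma orthonormalOLP_balanced (hμ : μ.support.Infinite) (n : ℕ) :
    orthonormalOLP μ balanced n =
      C ((((√(szegoNormSq μ n))⁻¹ : ℝ)) : ℂ) * monicOLP μ balanced n := by
  rw [orthonormalOLP, ip_monicOLP_balanced_self hμ, Complex.ofReal_re]

lemma sqrt_szegoNormSq_ne_zero (hμ : μ.support.Infinite) (n : ℕ) :
    ((√(szegoNormSq μ n) : ℝ) : ℂ) ≠ 0 :=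
  Complex.ofReal_ne_zero.2 (Real.sqrt_pos.2 (szegoNormSq_pos hμ n)).ne'

/-- `η_{n+1}` is the ratio of successive norms; this is why normalizing the monic recursion puts `η`
on its left side only. -/
lemma eta_mul_inv_sqrt (hμ : μ.support.Infinite) (n : ℕ) :
    eta (schur μ) (n + 1) * (((√(szegoNormSq μ (n + 1)))⁻¹ : ℝ) : ℂ) =
      (((√(szegoNormSq μ n))⁻¹ : ℝ) : ℂ) := by
  rw [Complex.ofReal_inv, Complex.ofReal_inv, sqrt_szegoNormSq_succ hμ]
  have h1 := eta_ne_zero (norm_schur_lt_one hμ n)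
  have h2 := sqrt_szegoNormSq_ne_zero hμ n
  field_simp

/-- The recursion at odd indices, `η_n χ_n = z χ̃_{n-1} + δ_n χ_{n-1}`. -/
lemma eta_mul_orthonormalOLP_odd (hμ : μ.support.Infinite) (k : ℕ) :
    C (eta (schur μ) (2 * k + 1)) * orthonormalOLP μ balanced (2 * k + 1) =
      reflect (orthonormalOLP μ balanced (2 * k)) * T 1 +
        C (schur μ (2 * k + 1)) * orthonormalOLP μ balanced (2 * k) := by
  rw [orthonormalOLP_balanced hμ, orthonormalOLP_balanced hμ, ← mul_assoc, ← map_mul C,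
    eta_mul_inv_sqrt hμ, monicOLP_balanced_odd hμ, monicOLP_balanced_even hμ,
    szegoPoly_succ hμ (2 * k)]
  simp only [map_mul, reflect_C, reflect_reflect, reflect_T, Complex.conj_ofReal]
  have e2 : (T ((2 * k : ℕ) : ℤ) : Laurent) * T (-(k : ℤ)) = T k := by
    rw [← T_add]; congr 1; push_cast; ring
  linear_combination (C (((√(szegoNormSq μ (2 * k)))⁻¹ : ℝ) : ℂ) * C (schur μ (2 * k + 1)) *
    reflect (szegoPoly μ (2 * k))) * e2

/-- The recursion at even indices, `η_n χ_n = χ̃_{n-1} + conj(δ_n) χ_{n-1}`. -/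
lemma eta_mul_orthonormalOLP_even (hμ : μ.support.Infinite) (k : ℕ) :
    C (eta (schur μ) (2 * k + 2)) * orthonormalOLP μ balanced (2 * k + 2) =
      reflect (orthonormalOLP μ balanced (2 * k + 1)) +
        C (conj (schur μ (2 * k + 2))) * orthonormalOLP μ balanced (2 * k + 1) := by
  have h := monicOLP_balanced_even hμ (k + 1)
  rw [show 2 * (k + 1) = 2 * k + 1 + 1 by ring] at h
  rw [orthonormalOLP_balanced hμ, orthonormalOLP_balanced hμ, ← mul_assoc, ← map_mul C,
    eta_mul_inv_sqrt hμ, monicOLP_balanced_odd hμ, h, szegoPoly_succ hμ (2 * k + 1)]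
  simp only [map_mul, map_add, reflect_C, reflect_reflect, reflect_T, Complex.conj_ofReal]
  have e1 : (T (-1) : Laurent) * T ((k + 1 : ℕ) : ℤ) = T (- -(k : ℤ)) := by
    rw [← T_add]; congr 1; push_cast; ring
  have e2 : (T (-((2 * k + 1 : ℕ) : ℤ)) : Laurent) * T ((k + 1 : ℕ) : ℤ) = T (-k) := by
    rw [← T_add]; congr 1; push_cast; ring
  linear_combination (C (((√(szegoNormSq μ (2 * k + 1)))⁻¹ : ℝ) : ℂ) *
    reflect (szegoPoly μ (2 * k + 1))) * e1 + (C (((√(szegoNormSq μ (2 * k + 1)))⁻¹ : ℝ) : ℂ) *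
    C (conj (schur μ (2 * k + 1 + 1))) * szegoPoly μ (2 * k + 1)) * e2

lemma orthonormalOLP_zero (hμ : μ.support.Infinite) : orthonormalOLP μ balanced 0 = 1 := by
  have h0 : szegoPoly μ 0 = 1 := by
    rw [szegoPoly, monicOLP]; simp [newMonomial_zero]
  have h1 : szegoNormSq μ 0 = 1 := by
    have : evC (1 : Laurent) = fun _ => 1 := funext fun w => map_one _
    simp [szegoNormSq, h0, this]
  have h2 := monicOLP_balanced_even hμ 0
  rw [orthonormalOLP_balanced hμ, h1]
  simp at h2
  simp [h2, h0]

lemma orthonormalOLP_mem (hμ : μ.support.Infinite) {i n : ℕ} (h : i < n) :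
    orthonormalOLP μ balanced i ∈ LaurentSpan (-(((n : ℤ) - 1) / 2)) ((n : ℤ) / 2) := by
  rw [orthonormalOLP_balanced hμ, ← priorSpan_balanced]
  exact C_mul_mem (monicOLP_mem μ balanced h) _

lemma ip_orthonormalOLP_of_mem (hμ : μ.support.Infinite) {n : ℕ} {f : Laurent}
    (hf : f ∈ LaurentSpan (-(((n : ℤ) - 1) / 2)) ((n : ℤ) / 2)) :
    ip μ (orthonormalOLP μ balanced n) f = 0 := by
  rw [← priorSpan_balanced] at hf
  rw [orthonormalOLP_balanced hμ, ip_C_mul_left, ip_monicOLP_of_mem hμ _ hf, mul_zero]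

lemma ip_orthonormalOLP (hμ : μ.support.Infinite) (i j : ℕ) :
    ip μ (orthonormalOLP μ balanced i) (orthonormalOLP μ balanced j) = if i = j then 1 else 0 := by
  rcases lt_trichotomy i j with h | rfl | h
  · rw [if_neg h.ne]
    exact ip_eq_zero_symm (ip_orthonormalOLP_of_mem hμ (orthonormalOLP_mem hμ h))
  · rw [if_pos rfl, orthonormalOLP_balanced hμ, ip_C_mul_left, ip_C_mul_right,
      ip_monicOLP_balanced_self hμ, Complex.conj_ofReal]
    norm_cast
    have h1 := szegoNormSq_pos hμ i
    have h2 := Real.mul_self_sqrt h1.le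
    have h3 := (Real.sqrt_pos.2 h1).ne'
    rw [← mul_assoc, ← mul_inv, h2, inv_mul_cancel₀ h1.ne']
  · rw [if_neg h.ne']
    exact ip_orthonormalOLP_of_mem hμ (orthonormalOLP_mem hμ h)

/-! ### The nodal Laurent polynomial -/

lemma step_balanced_odd (k : ℕ) : step balanced (2 * k + 1) = 0 := by
  unfold step balanced; omega

lemma step_balanced_even (k : ℕ) : step balanced (2 * k + 2) ≠ 0 := by
  unfold step balanced; omega

/-- The term `τ_n χ_{n-1}` exchanges `δ_n` for `u` in the recursion, which removes `χ_n` from the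
expression of `R_n`. -/
lemma nodal_odd (hμ : μ.support.Infinite) (k : ℕ) (u : Circle) :
    nodal μ (2 * k + 1) u = reflect (orthonormalOLP μ balanced (2 * k)) * T 1 +
      C (u : ℂ) * orthonormalOLP μ balanced (2 * k) := by
  rw [nodal, eta_mul_orthonormalOLP_odd hμ, tau, if_pos (step_balanced_odd k),
    Nat.add_sub_cancel, map_sub]
  ring

lemma nodal_even (hμ : μ.support.Infinite) (k : ℕ) (u : Circle) :
    nodal μ (2 * k + 2) u = reflect (orthonormalOLP μ balanced (2 * k + 1)) +
      C (conj (u : ℂ)) * orthonormalOLP μ balanced (2 * k + 1) := by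
  rw [nodal, eta_mul_orthonormalOLP_even hμ, tau, if_neg (step_balanced_even k), map_sub, map_sub,
    show 2 * k + 2 - 1 = 2 * k + 1 by omega]
  ring

/-- The nodal Laurent polynomial is self-reciprocal up to a unit. -/
lemma exists_reflect_nodal (hμ : μ.support.Infinite) {n : ℕ} (hn : 0 < n) (u : Circle) :
    ∃ c : ℂ, c ≠ 0 ∧
      reflect (nodal μ n u) = C c * nodal μ n u * T ((n / 2 : ℕ) - ((n + 1) / 2 : ℕ) : ℤ) := by
  have hu : (C (conj (u : ℂ)) : Laurent) * C (u : ℂ) = 1 := by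
    rw [← map_mul C, mul_comm, Complex.mul_conj, Circle.normSq_coe]; simp
  have hT : (T 1 : Laurent) * T (-1) = 1 := by rw [← T_add]; simp
  obtain ⟨m, rfl⟩ := Nat.exists_eq_succ_of_ne_zero hn.ne'
  obtain ⟨k, rfl | rfl⟩ := Nat.even_or_odd' m
  · refine ⟨conj (u : ℂ), by simp, ?_⟩
    rw [Nat.succ_eq_add_one, nodal_odd hμ,
      show (((2 * k + 1) / 2 : ℕ) - ((2 * k + 1 + 1) / 2 : ℕ) : ℤ) = -1 by omega]
    simp only [map_add, map_mul, reflect_reflect, reflect_T, reflect_C]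
    linear_combination (-(C (conj (u : ℂ))) * reflect (orthonormalOLP μ balanced (2 * k))) * hT -
      T (-1) * orthonormalOLP μ balanced (2 * k) * hu
  · refine ⟨u, by simp, ?_⟩
    rw [Nat.succ_eq_add_one, nodal_even hμ,
      show (((2 * k + 1 + 1) / 2 : ℕ) - ((2 * k + 1 + 1 + 1) / 2 : ℕ) : ℤ) = 0 by omega]
    simp only [map_add, map_mul, reflect_reflect, reflect_C, Complex.conj_conj, T_zero]
    linear_combination -orthonormalOLP μ balanced (2 * k + 1) * hu

lemma nodal_mem (hμ : μ.support.Infinite) (n : ℕ) (u : Circle) :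
    nodal μ n u ∈ LaurentSpan (-(n / 2 : ℕ)) ((n + 1) / 2 : ℕ) := by
  have h (i : ℕ) (hi : i < n + 1) :
      orthonormalOLP μ balanced i ∈ LaurentSpan (-(n / 2 : ℕ)) ((n + 1) / 2 : ℕ) :=
    LaurentSpan_mono (by push_cast; omega) (by push_cast; omega) (orthonormalOLP_mem hμ hi)
  exact add_mem (C_mul_mem (h n (by omega)) _) (C_mul_mem (h (n - 1) (by omega)) _)

/-- The test space is the span of the first `n - 1` monomials of the ordering, to which both
`χ_{n-1}` and `χ_n` are orthogonal. -/
lemma ip_nodal_of_mem (hμ : μ.support.Infinite) {n : ℕ} (hn : 0 < n) (u : Circle) {f : Laurent}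
    (hf : f ∈ LaurentSpan (1 - (n / 2 : ℕ)) (n - 1 - (n / 2 : ℕ))) :
    ip μ (nodal μ n u) f = 0 := by
  rw [nodal, ip_add_left, ip_C_mul_left, ip_C_mul_left,
    ip_orthonormalOLP_of_mem hμ (LaurentSpan_mono (by omega) (by omega) hf),
    ip_orthonormalOLP_of_mem hμ (n := n - 1) (LaurentSpan_mono (by omega) (by omega) hf)]
  ring

/-- The monomial adjoined at the `n`-th stage occurs in `χ_n` and hence in `R_n`; by
self-reciprocity both extreme coefficients of `R_n` are nonzero. -/
lemma coeff_nodal_ne_zero (hμ : μ.support.Infinite) {n : ℕ} (hn : 0 < n) (u : Circle) :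
    (nodal μ n u).coeff (-(n / 2 : ℕ)) ≠ 0 ∧ (nodal μ n u).coeff ((n + 1) / 2 : ℕ) ≠ 0 := by
  have hsymm : (nodal μ n u).coeff (-(n / 2 : ℕ)) ≠ 0 ↔
      (nodal μ n u).coeff ((n + 1) / 2 : ℕ) ≠ 0 := by
    obtain ⟨c, hc, h⟩ := exists_reflect_nodal hμ hn u
    have := congrArg (fun f : Laurent => f.coeff (n / 2 : ℕ)) h
    simp only [coeff_reflect, mul_assoc, coeff_C_mul, coeff_mul_T, sub_sub_cancel] at this
    rw [← map_ne_zero (starRingEnd ℂ), this]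
    simp [hc]
  obtain ⟨m, rfl⟩ := Nat.exists_eq_succ_of_ne_zero hn.ne'
  have key (e : ℤ) (he : newMonomial balanced (m + 1) = T e)
      (he' : e < -(((m + 1 : ℕ) - 1 : ℤ) / 2) ∨ ((m + 1 : ℕ) : ℤ) / 2 < e) :
      (nodal μ (m + 1) u).coeff e ≠ 0 := by
    have h1 : (monicOLP μ balanced (m + 1)).coeff e = 1 := by
      have := monicOLP_sub_mem μ balanced (m + 1)
      rw [priorSpan_balanced, he] at this
      simpa [sub_eq_zero] using coeff_eq_zero_of_mem this he'
    have h2 := coeff_eq_zero_of_mem (orthonormalOLP_mem hμ (Nat.lt_succ_self m)) he'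
    rw [nodal, AddMonoidAlgebra.coeff_add, Finsupp.add_apply, coeff_C_mul, coeff_C_mul,
      Nat.add_sub_cancel, h2, orthonormalOLP_balanced hμ, coeff_C_mul, h1, mul_one, mul_zero,
      add_zero, eta_mul_inv_sqrt hμ, Complex.ofReal_inv]
    exact inv_ne_zero (sqrt_szegoNormSq_ne_zero hμ m)
  obtain ⟨k, rfl | rfl⟩ := Nat.even_or_odd' m
  · have h := key (((2 * k + 1 + 1) / 2 : ℕ) : ℤ) (by
      rw [newMonomial_balanced_odd]; congr 1; omega) (by push_cast; omega)
    exact ⟨hsymm.2 h, h⟩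
  · have h := key (-((2 * k + 1 + 1) / 2 : ℕ) : ℤ) (by
      rw [show 2 * k + 1 + 1 = 2 * (k + 1) by ring, newMonomial_balanced_even]; congr 1; omega)
      (by push_cast; omega)
    exact ⟨h, hsymm.1 h⟩

end Balanced

section Eigenvectors

variable {μ : Measure Circle} [IsProbabilityMeasure μ]

/-! ### Eigenvectors of truncated CMV matrices -/

lemma cmv_zero_apply (δ : ℕ → ℂ) (j : ℕ) :
    cmv δ 0 j = (if j = 0 then -δ 1 else 0) + (if j = 1 then eta δ 1 else 0) := by
  rw [cmv]; split_ifs <;> first | omega | simp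

lemma cmv_odd_apply (δ : ℕ → ℂ) (k j : ℕ) :
    cmv δ (2 * k + 1) j =
      (if j = 2 * k then -(eta δ (2 * k + 1) * δ (2 * k + 2)) else 0) +
      (if j = 2 * k + 1 then -(conj (δ (2 * k + 1)) * δ (2 * k + 2)) else 0) +
      (if j = 2 * k + 2 then -(eta δ (2 * k + 2) * δ (2 * k + 3)) else 0) +
      (if j = 2 * k + 3 then eta δ (2 * k + 2) * eta δ (2 * k + 3) else 0) := by
  rw [cmv, if_neg (by omega), if_pos ⟨k, rfl⟩]
  split_ifs <;> first | omega | simp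

lemma cmv_even_apply (δ : ℕ → ℂ) (k j : ℕ) :
    cmv δ (2 * k + 2) j =
      (if j = 2 * k then eta δ (2 * k + 1) * eta δ (2 * k + 2) else 0) +
      (if j = 2 * k + 1 then conj (δ (2 * k + 1)) * eta δ (2 * k + 2) else 0) +
      (if j = 2 * k + 2 then -(conj (δ (2 * k + 2)) * δ (2 * k + 3)) else 0) +
      (if j = 2 * k + 3 then conj (δ (2 * k + 2)) * eta δ (2 * k + 3) else 0) := by
  rw [cmv, if_neg (by omega), if_neg (by rw [Nat.odd_iff]; omega)]
  split_ifs <;> first | omega | simp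

/-- A finitely supported solution of the recursions for the values of the orthonormal Laurent
polynomials at a point `w` of the circle is an eigenvector of the CMV matrix. -/
lemma sum_cmv_mul {δ c : ℕ → ℂ} {n : ℕ} {w : ℂ} (hw : w * conj w = 1)
    (hδ : ∀ k, 0 < k → k < n → ‖δ k‖ < 1) (hη : eta δ n = 0) (hc : ∀ j, n ≤ j → c j = 0)
    (h0 : conj (c 0) = c 0)
    (hodd : ∀ k, 2 * k + 1 ≤ n →
      eta δ (2 * k + 1) * c (2 * k + 1) = conj (c (2 * k)) * w + δ (2 * k + 1) * c (2 * k))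
    (heven : ∀ k, 2 * k + 2 ≤ n →
      eta δ (2 * k + 2) * c (2 * k + 2) =
        conj (c (2 * k + 1)) + conj (δ (2 * k + 2)) * c (2 * k + 1))
    {i : ℕ} (hi : i < n) : ∑ j ∈ Finset.range n, cmv δ i j * c j = w * c i := by
  -- Extending the range by zeros of `c` brings all columns of row `i` into the sum, so truncation
  -- creates no boundary cases.
  have hext : ∑ j ∈ Finset.range n, cmv δ i j * c j =
      ∑ j ∈ Finset.range (n + 3), cmv δ i j * c j := by
    refine Finset.sum_subset (Finset.range_mono (by omega)) fun j _ hj => ?_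
    rw [hc j (by simpa using hj), mul_zero]
  -- Backward recursions: conjugate a forward step and eliminate with `η² = 1 - |δ|²` and `|w| = 1`.
  -- Dividing by `η` requires an index strictly below `n`.
  have inv_odd (k : ℕ) (hk : 2 * k + 1 < n) : w * conj (c (2 * k + 1)) =
      eta δ (2 * k + 1) * c (2 * k) + conj (δ (2 * k + 1)) * c (2 * k + 1) := by
    have h1 := hodd k hk.le
    have h2 := congrArg conj h1
    simp only [map_mul, map_add, Complex.conj_conj, conj_eta] at h2
    have h3 := eta_mul_self (hδ _ (by omega) hk).le
    refine mul_left_cancel₀ (eta_ne_zero (hδ _ (by omega) hk)) ?_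
    linear_combination w * h2 - conj (δ (2 * k + 1)) * h1 - c (2 * k) * h3 + c (2 * k) * hw
  have inv_even (k : ℕ) (hk : 2 * k + 2 < n) : conj (c (2 * k + 2)) =
      eta δ (2 * k + 2) * c (2 * k + 1) + δ (2 * k + 2) * c (2 * k + 2) := by
    have h1 := heven k hk.le
    have h2 := congrArg conj h1
    simp only [map_mul, map_add, Complex.conj_conj, conj_eta] at h2
    have h3 := eta_mul_self (hδ _ (by omega) hk).le
    refine mul_left_cancel₀ (eta_ne_zero (hδ _ (by omega) hk)) ?_
    linear_combination h2 - δ (2 * k + 2) * h1 - c (2 * k + 1) * h3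
  -- In an odd row `2k+1`, the columns pair up into `-δ_{2k+2} w conj(c_{2k+1}) + η_{2k+2} w
  -- conj(c_{2k+2})`, which the conjugated forward step turns into `w c_{2k+1}`. Even rows beyond
  -- row 0 use the backward step in the same way.
  rw [hext]
  rcases i with _ | i
  · have h1 := hodd 0 (by omega)
    simp only [cmv_zero_apply, add_mul, ite_mul, zero_mul, Finset.sum_add_distrib,
      Finset.sum_ite_eq', Finset.mem_range]
    rw [if_pos (by omega), if_pos (by omega)]
    simp only [mul_zero, zero_add] at h1
    linear_combination h1 + w * h0
  · obtain ⟨k, rfl | rfl⟩ := Nat.even_or_odd' i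
    · have h1 := congrArg conj (heven k (by omega))
      simp only [map_mul, map_add, Complex.conj_conj, conj_eta] at h1
      have h2 := inv_odd k hi
      -- In the last row the recursion at `2k+3` lies beyond `n`, but the factor `η_n = 0` makes it
      -- unnecessary.
      have h3 : eta δ (2 * k + 2) * (eta δ (2 * k + 3) * c (2 * k + 3)) = eta δ (2 * k + 2) *
          (conj (c (2 * k + 2)) * w + δ (2 * k + 3) * c (2 * k + 2)) := by
        by_cases hn : 2 * k + 2 = n
        · rw [hn, hη, zero_mul, zero_mul]
        · exact congrArg _ (hodd (k + 1) (by omega))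
      simp only [cmv_odd_apply, add_mul, ite_mul, zero_mul, Finset.sum_add_distrib,
        Finset.sum_ite_eq', Finset.mem_range]
      rw [if_pos (by omega), if_pos (by omega), if_pos (by omega), if_pos (by omega)]
      linear_combination h3 + w * h1 + δ (2 * k + 2) * h2
    · have h1 := congrArg conj (inv_even k hi)
      simp only [map_mul, map_add, Complex.conj_conj, conj_eta] at h1
      have h2 := inv_odd k (by omega)
      have h3 := hodd (k + 1) (by omega)
      rw [show 2 * (k + 1) = 2 * k + 2 by ring] at h3
      rw [show 2 * k + 1 + 1 = 2 * k + 2 by ring]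
      simp only [cmv_even_apply, add_mul, ite_mul, zero_mul, Finset.sum_add_distrib,
        Finset.sum_ite_eq', Finset.mem_range]
      rw [if_pos (by omega), if_pos (by omega), if_pos (by omega), if_pos (by omega)]
      linear_combination conj (δ (2 * k + 2)) * h3 - w * h1 - eta δ (2 * k + 2) * h2

/-- At a zero `w` of the nodal Laurent polynomial, the values of the orthonormal Laurent
polynomials form an eigenvector of the truncated CMV matrix. -/
lemma cmvTrunc_mulVec (hμ : μ.support.Infinite) {n : ℕ} (hn : 0 < n) (u w : Circle)
    (hR : evC (nodal μ n u) w = 0) (i : Fin n) :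
    ∑ j, cmvTrunc (schur μ) n u i j * evC (orthonormalOLP μ balanced j) w =
      w * evC (orthonormalOLP μ balanced i) w := by
  set δ := Function.update (schur μ) n (u : ℂ) with hδdef
  -- Cut off at `n`: with `η_n = 0`, the recursion at index `n` is exactly the equation `R_n(w) =
  -- 0`.
  set c : ℕ → ℂ := fun j => if j < n then evC (orthonormalOLP μ balanced j) w else 0 with hcdef
  have hδ (k : ℕ) (hk : k < n) : δ k = schur μ k := Function.update_of_ne hk.ne _ _
  have hδn : δ n = u := Function.update_self _ _ _
  have hηn : eta δ n = 0 := by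
    have : ‖(u : ℂ)‖ = 1 := Circle.norm_coe u
    simp [eta, hδn, this]
  have hηδ (k : ℕ) (hk : k < n) : eta δ k = eta (schur μ) k := by rw [eta, eta, hδ k hk]
  have hc (k : ℕ) (hk : k < n) : c k = evC (orthonormalOLP μ balanced k) w := if_pos hk
  have key := sum_cmv_mul (δ := δ) (c := c) (n := n) (w := w)
    (by rw [Complex.mul_conj, Circle.normSq_coe, Complex.ofReal_one])
    (fun k h1 h2 => by
      rw [hδ k h2]
      obtain ⟨m, rfl⟩ := Nat.exists_eq_succ_of_ne_zero h1.ne'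
      exact norm_schur_lt_one hμ m) hηn (fun j hj => if_neg (by omega))
    (by rw [hc 0 hn, orthonormalOLP_zero hμ, show evC (1 : Laurent) w = 1 from map_one _, map_one])
    (fun k hk => by
      rcases hk.lt_or_eq with hk | rfl
      · have := congrArg (fun f => evC f w) (eta_mul_orthonormalOLP_odd hμ k)
        simp only [evC_mul, evC_add, evC_C, evC_T, evC_reflect, zpow_one] at this
        rw [hc _ hk, hc _ (by omega), hδ _ hk, hηδ _ hk, this]
      · rw [nodal_odd hμ] at hR
        simp only [evC_mul, evC_add, evC_C, evC_T, evC_reflect, zpow_one] at hR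
        rw [hηn, hδn, hc (2 * k) (by omega), hR, zero_mul])
    (fun k hk => by
      rcases hk.lt_or_eq with hk | rfl
      · have := congrArg (fun f => evC f w) (eta_mul_orthonormalOLP_even hμ k)
        simp only [evC_mul, evC_add, evC_C, evC_reflect] at this
        rw [hc _ hk, hc _ (by omega), hδ _ hk, hηδ _ hk, this]
      · rw [nodal_even hμ] at hR
        simp only [evC_mul, evC_add, evC_C, evC_reflect] at hR
        rw [hηn, hδn, hc (2 * k + 1) (by omega), hR, zero_mul])
    i.2
  rw [hc i i.2, Finset.sum_range] at key
  rw [← key]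
  exact Finset.sum_congr rfl fun j _ => by rw [hc j j.2]; rfl

/-! ### Consequences of exactness -/

open Matrix in
/-- An eigenvector of a matrix diagonalized by `V` is a multiple of a column of `V`. -/
lemma exists_smul_col_of_mulVec {n : ℕ} {M V B : Matrix (Fin n) (Fin n) ℂ} {z : Fin n → ℂ}
    (hz : Function.Injective z) (hMV : M * V = V * diagonal z) (hVB : V * B = 1)
    {x : ℂ} {v : Fin n → ℂ} (hv : v ≠ 0) (hx : M *ᵥ v = x • v) :
    ∃ j, z j = x ∧ ∃ a : ℂ, ∀ i, v i = a * V i j := by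
  have hBV : B * V = 1 := mul_eq_one_comm.1 hVB
  set a := B *ᵥ v with ha
  have hva : v = V *ᵥ a := by rw [ha, mulVec_mulVec, hVB, one_mulVec]
  have hdiag : diagonal z *ᵥ a = x • a := by
    have : diagonal z = B * (M * V) := by rw [hMV, ← mul_assoc, hBV, one_mul]
    rw [this, ← mulVec_mulVec, ← mulVec_mulVec, ← hva, hx, mulVec_smul]
  have hcomp (j : Fin n) : z j * a j = x * a j := by
    simpa [mulVec_diagonal] using congrFun hdiag j
  have ha0 : a ≠ 0 := by
    intro h
    rw [h, mulVec_zero] at hva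
    exact hv hva
  obtain ⟨j, hj⟩ := Function.ne_iff.1 ha0
  have hzj : z j = x := mul_right_cancel₀ hj (hcomp j)
  refine ⟨j, hzj, a j, fun i => ?_⟩
  rw [hva, mulVec, dotProduct, Finset.sum_eq_single j]
  · ring
  · intro k _ hk
    have : a k = 0 := by
      by_contra h
      exact hk (hz ((mul_right_cancel₀ h (hcomp k)).trans hzj.symm))
    rw [this, mul_zero]
  · simp

open Matrix in
/-- Exactness turns orthonormality into the discrete orthonormality relations, whose dual
expresses the weights. -/
lemma mul_eq_one_of_exact (hμ : μ.support.Infinite) {n : ℕ} {z : Fin n → Circle}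
    {lam : Fin n → ℂ}
    (h : ∀ L ∈ LaurentSpan (-((n : ℤ) - 1)) ((n : ℤ) - 1),
      ∑ j, lam j * evC L (z j) = ∫ w, evC L w ∂μ) :
    (of fun i j : Fin n => evC (orthonormalOLP μ balanced i) (z j)) *
      (of fun j i : Fin n => lam j * conj (evC (orthonormalOLP μ balanced i) (z j))) = 1 := by
  ext i k
  -- Both factors have exponents between `-⌊(n-1)/2⌋` and `⌊n/2⌋` before reflection, and `⌊(n-1)/2⌋
  -- + ⌊n/2⌋ = n - 1`, exactly the range of exactness.
  have hmem : orthonormalOLP μ balanced i * reflect (orthonormalOLP μ balanced k) ∈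
      LaurentSpan (-((n : ℤ) - 1)) ((n : ℤ) - 1) :=
    LaurentSpan_mono (by omega) (by omega) (mul_mem_LaurentSpan (orthonormalOLP_mem hμ i.2)
      (reflect_mem (orthonormalOLP_mem hμ k.2)))
  have h1 := h _ hmem
  have h2 := ip_orthonormalOLP hμ i k
  rw [ip_eq_moment, moment, LinearMap.coe_mk, AddHom.coe_mk, ← h1] at h2
  rw [mul_apply, one_apply]
  simp only [Fin.ext_iff]
  rw [← h2]
  refine Finset.sum_congr rfl fun j _ => ?_
  rw [evC_mul, evC_reflect, of_apply, of_apply]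
  ring

/-- A right inverse of a square matrix is also a left inverse; this is the diagonal of that second
identity. It shows that even complex weights are forced to be positive. -/
lemma weight_mul_sum_eq_one (hμ : μ.support.Infinite) {n : ℕ} {z : Fin n → Circle}
    {lam : Fin n → ℂ}
    (h : ∀ L ∈ LaurentSpan (-((n : ℤ) - 1)) ((n : ℤ) - 1),
      ∑ j, lam j * evC L (z j) = ∫ w, evC L w ∂μ) (j : Fin n) :
    lam j * ((∑ i : Fin n, ‖evC (orthonormalOLP μ balanced i) (z j)‖ ^ 2 : ℝ) : ℂ) = 1 := by
  have h1 := congrArg (fun A : Matrix (Fin n) (Fin n) ℂ => A j j)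
    (mul_eq_one_comm.1 (mul_eq_one_of_exact hμ h))
  simp only [Matrix.mul_apply, Matrix.one_apply_eq] at h1
  rw [← h1, Complex.ofReal_sum, Finset.mul_sum]
  refine Finset.sum_congr rfl fun i _ => ?_
  rw [Matrix.of_apply, Matrix.of_apply, mul_assoc, mul_comm (conj _), Complex.mul_conj,
    Complex.normSq_eq_norm_sq]

/-- The nodes of a Szegő quadrature formula are the eigenvalues of the truncated CMV matrix, and
its weights are the squared moduli of the first components of the unit eigenvectors. -/
lemma IsSzegoQuadrature.eigen (hμ : μ.support.Infinite) {n : ℕ} (hn : 0 < n) {u : Circle}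
    {z : Fin n → Circle} {lam : Fin n → ℂ} (h : IsSzegoQuadrature μ n u z lam) :
    (∀ x : ℂ, Module.End.HasEigenvalue (Matrix.toLin' (cmvTrunc (schur μ) n (u : ℂ))) x ↔
      ∃ j, (z j : ℂ) = x) ∧
    ∀ (j : Fin n) (v : Fin n → ℂ),
      Module.End.HasEigenvector (Matrix.toLin' (cmvTrunc (schur μ) n (u : ℂ))) (z j : ℂ) v →
        ∑ i, ‖v i‖ ^ 2 = 1 → lam j = ((‖v ⟨0, hn⟩‖ ^ 2 : ℝ) : ℂ) := by
  set M := cmvTrunc (schur μ) n (u : ℂ) with hM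
  set V : Matrix (Fin n) (Fin n) ℂ :=
    Matrix.of fun i j : Fin n => evC (orthonormalOLP μ balanced i) (z j) with hV
  have hV0 (j : Fin n) : V ⟨0, hn⟩ j = 1 := by
    simp only [hV, Matrix.of_apply, orthonormalOLP_zero hμ]
    exact map_one _
  have hcol (i j : Fin n) : ∑ k, M i k * V k j = z j * V i j :=
    cmvTrunc_mulVec hμ hn u (z j) ((h.nodes _).2 ⟨j, rfl⟩) i
  have hMV : M * V = V * Matrix.diagonal fun j => (z j : ℂ) := by
    ext i j
    rw [Matrix.mul_apply, hcol, Matrix.mul_diagonal, mul_comm]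
  have hVB := mul_eq_one_of_exact hμ h.exact_on
  have hz : Function.Injective fun j => (z j : ℂ) := Circle.coe_injective.comp h.distinct
  refine ⟨fun x => ⟨fun hx => ?_, ?_⟩, fun j v hv hnorm => ?_⟩
  · obtain ⟨v, hv⟩ := hx.exists_hasEigenvector
    obtain ⟨j, hj, -⟩ := exists_smul_col_of_mulVec hz hMV hVB hv.2 hv.apply_eq_smul
    exact ⟨j, hj⟩
  · rintro ⟨j, rfl⟩
    refine Module.End.hasEigenvalue_of_hasEigenvector (x := fun i => V i j)
      (Module.End.hasEigenvector_iff.2 ⟨Module.End.mem_eigenspace_iff.2 ?_, fun h0 => ?_⟩)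
    · funext i
      exact hcol i j
    · simpa [hV0] using congrFun h0 ⟨0, hn⟩
  · obtain ⟨k, hk, a, ha⟩ := exists_smul_col_of_mulVec hz hMV hVB hv.2 hv.apply_eq_smul
    obtain rfl : k = j := hz hk
    have hw := weight_mul_sum_eq_one hμ h.exact_on k
    rw [ha, hV0, mul_one]
    simp only [ha, norm_mul, mul_pow] at hnorm
    rw [← Finset.mul_sum] at hnorm
    have hnorm' := congrArg (fun r : ℝ => (r : ℂ)) hnorm
    simp only [Complex.ofReal_mul, Complex.ofReal_one] at hnorm'
    have hS : ((∑ i : Fin n, ‖V i k‖ ^ 2 : ℝ) : ℂ) ≠ 0 := right_ne_zero_of_mul_eq_one hw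
    -- Since `χ_0 = 1`, the scalar `a` is `v_0`, and `λ_j` and `|a|²` are both inverse to the
    -- squared norm of column `k`.
    exact mul_right_cancel₀ hS (hw.trans hnorm'.symm)

end Eigenvectors

section Existence

/-! ### Zeros of the nodal Laurent polynomial -/

lemma ev_reflect (f : Laurent) (x : ℂˣ) : ev (reflect f) x = conj (ev f (star x)⁻¹) := by
  induction f using LaurentPolynomial.induction_on' with
  | add p q hp hq => simp [map_add, ev_add, hp, hq]
  | C_mul_T k a => simp [ev_mul]

lemma ev_nodal_eq_zero_iff {μ : Measure Circle} {n : ℕ} {u : Circle} {P : Polynomial ℂ}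
    (hP : Polynomial.toLaurent P = nodal μ n u * T (n / 2 : ℕ)) (x : ℂˣ) :
    ev (nodal μ n u) x = 0 ↔ P.eval (x : ℂ) = 0 := by
  rw [← ev_toLaurent, hP, ev_mul, ev_T, mul_eq_zero, or_iff_left]
  exact zpow_ne_zero _ x.ne_zero

variable {μ : Measure Circle} [IsProbabilityMeasure μ]

/-- Both extreme coefficients of `R_n` are nonzero, so clearing the pole at 0 gives degree exactly
`n` without adding a root at 0. -/
lemma exists_nodal_polynomial (hμ : μ.support.Infinite) {n : ℕ} (hn : 0 < n) (u : Circle) :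
    ∃ P : Polynomial ℂ, P.natDegree = n ∧ P.coeff 0 ≠ 0 ∧
      Polynomial.toLaurent P = nodal μ n u * T (n / 2 : ℕ) := by
  obtain ⟨P, hdeg, hP⟩ := exists_toLaurent_eq (d := n)
    (LaurentSpan_mono (by omega) (by omega) (mul_T_mem (nodal_mem hμ n u) (n / 2 : ℕ)))
  have hcoeff (k : ℕ) : P.coeff k = (nodal μ n u).coeff (k - (n / 2 : ℕ)) := by
    rw [← coeff_toLaurent_natCast, hP, coeff_mul_T]
  obtain ⟨h1, h2⟩ := coeff_nodal_ne_zero hμ hn u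
  refine ⟨P, le_antisymm hdeg (Polynomial.le_natDegree_of_ne_zero ?_), ?_, hP⟩
  · rwa [hcoeff, show (n : ℤ) - (n / 2 : ℕ) = ((n + 1) / 2 : ℕ) by omega]
  · rwa [hcoeff, Nat.cast_zero, zero_sub]

/-- `R_n` has no pair of zeros symmetric with respect to the circle, and no double zero on it. -/
lemma not_mul_dvd_nodal (hμ : μ.support.Infinite) {n : ℕ} (hn : 0 < n) (u : Circle)
    {P : Polynomial ℂ} (hdeg : P.natDegree = n)
    (hP : Polynomial.toLaurent P = nodal μ n u * T (n / 2 : ℕ)) {x : ℂ} (hx : x ≠ 0) :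
    ¬ (Polynomial.X - Polynomial.C x) * (Polynomial.X - Polynomial.C (conj x)⁻¹) ∣ P := by
  rintro ⟨Q, hQ⟩
  have hP0 : P ≠ 0 := by rintro rfl; simp at hdeg; omega
  have hQ0 : Q ≠ 0 := by rintro rfl; simp [hP0] at hQ
  have hdegQ : 2 + Q.natDegree = n := by
    rw [← hdeg, hQ, Polynomial.natDegree_mul (mul_ne_zero (Polynomial.X_sub_C_ne_zero _)
      (Polynomial.X_sub_C_ne_zero _)) hQ0, Polynomial.natDegree_mul (Polynomial.X_sub_C_ne_zero _)
      (Polynomial.X_sub_C_ne_zero _)]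
    simp
  set f : Laurent := Polynomial.toLaurent Q * T (1 - (n / 2 : ℕ)) with hf
  have hfmem : f ∈ LaurentSpan (1 - (n / 2 : ℕ)) (n - 1 - (n / 2 : ℕ)) :=
    LaurentSpan_mono (by omega) (by omega)
      (mul_T_mem (toLaurent_mem_LaurentSpan (d := n - 2) (by omega)) _)
  have hx' : conj x ≠ 0 := (map_ne_zero _).2 hx
  -- The factor at the mirror point is a multiple of `z` times the reflection of `z - x`; the extra
  -- `z` is the `1` in the exponent defining `f`. Hence `⟨R_n, f⟩` is a nonzero multiple of `‖(z -
  -- x) f‖²`, while orthogonality makes it zero.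
  have hfac : (T 1 - C (conj x)⁻¹ : Laurent) =
      C (-(conj x)⁻¹) * (reflect (T 1 - C x) * T 1) := by
    have e1 : (T (-1) : Laurent) * T 1 = 1 := by rw [← T_add]; simp
    have e2 : (C (conj x)⁻¹ : Laurent) * C (conj x) = 1 := by
      rw [← map_mul C, inv_mul_cancel₀ hx', map_one]
    rw [map_sub, reflect_T, reflect_C, map_neg]
    linear_combination (C (conj x)⁻¹ : Laurent) * e1 - T 1 * e2
  have hnodal : nodal μ n u = C (-(conj x)⁻¹) * ((T 1 - C x) * f * reflect (T 1 - C x)) := by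
    have e : nodal μ n u = Polynomial.toLaurent P * T (-(n / 2 : ℕ)) := by
      rw [hP, mul_T_assoc]; simp
    rw [e, hQ]
    simp only [map_mul, map_sub, Polynomial.toLaurent_X, Polynomial.toLaurent_C]
    rw [← map_sub reflect, hfac, hf, sub_eq_add_neg (1 : ℤ), T_add]
    ring
  have h0 := ip_nodal_of_mem hμ hn u hfmem
  have hip : ip μ (nodal μ n u) f =
      -(conj x)⁻¹ * ip μ ((T 1 - C x) * f) ((T 1 - C x) * f) := by
    rw [hnodal, ip_C_mul_left, ip_eq_moment, ip_eq_moment, map_mul reflect (T 1 - C x) f]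
    congr 2
    ring
  rw [hip, mul_eq_zero] at h0
  have hg := ip_self_eq_zero hμ (h0.resolve_left (neg_ne_zero.2 (inv_ne_zero hx')))
  rw [hg, zero_mul, mul_zero] at hnodal
  rw [hnodal, zero_mul, Polynomial.toLaurent_eq_zero] at hP
  exact hP0 hP

/-- Self-reciprocity makes the mirror point `1 / conj x` a root as well. If it differed from `x`,
the two coprime linear factors would together divide `P`, which is excluded. -/
lemma norm_eq_one_of_root (hμ : μ.support.Infinite) {n : ℕ} (hn : 0 < n) (u : Circle)
    {P : Polynomial ℂ} (hdeg : P.natDegree = n)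
    (hP : Polynomial.toLaurent P = nodal μ n u * T (n / 2 : ℕ)) {x : ℂ} (hx : x ≠ 0)
    (hroot : P.eval x = 0) : ‖x‖ = 1 := by
  set y : ℂˣ := (star (Units.mk0 x hx))⁻¹ with hy
  have hyv : (y : ℂ) = (conj x)⁻¹ := by simp [hy]
  have hyroot : P.eval (y : ℂ) = 0 := by
    rw [← ev_nodal_eq_zero_iff hP]
    obtain ⟨c, -, hc⟩ := exists_reflect_nodal hμ hn u
    have h1 := congrArg (fun f => ev f (Units.mk0 x hx)) hc
    simp only [ev_reflect, ev_mul] at h1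
    rw [(ev_nodal_eq_zero_iff hP (Units.mk0 x hx)).2 hroot, mul_zero, zero_mul, map_eq_zero] at h1
    exact h1
  rw [hyv] at hyroot
  have hxy : (conj x)⁻¹ = x := by
    by_contra hne
    refine not_mul_dvd_nodal hμ hn u hdeg hP hx (IsCoprime.mul_dvd ?_
      (Polynomial.dvd_iff_isRoot.2 hroot) (Polynomial.dvd_iff_isRoot.2 hyroot))
    exact Polynomial.isCoprime_X_sub_C_of_isUnit_sub (sub_ne_zero.2 (Ne.symm hne)).isUnit
  have h1 : x * conj x = 1 := by
    nth_rw 1 [← hxy]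
    exact inv_mul_cancel₀ ((map_ne_zero _).2 hx)
  rw [Complex.mul_conj, Complex.normSq_eq_norm_sq] at h1
  have h2 : ‖x‖ ^ 2 = 1 := by exact_mod_cast h1
  exact (pow_eq_one_iff_of_nonneg (norm_nonneg x) two_ne_zero).1 h2

/-- The zeros of `R_n` are `n` distinct points of the circle. -/
lemma exists_nodes (hμ : μ.support.Infinite) {n : ℕ} (hn : 0 < n) (u : Circle)
    {P : Polynomial ℂ} (hdeg : P.natDegree = n) (h0 : P.coeff 0 ≠ 0)
    (hP : Polynomial.toLaurent P = nodal μ n u * T (n / 2 : ℕ)) :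
    P.roots.Nodup ∧ ∃ z : Fin n → Circle, Function.Injective z ∧
      ∀ x : ℂ, P.eval x = 0 ↔ ∃ j, (z j : ℂ) = x := by
  have hP0 : P ≠ 0 := by rintro rfl; simp at h0
  have hne (x : ℂ) (hx : P.eval x = 0) : x ≠ 0 := by
    rintro rfl
    exact h0 (by rwa [Polynomial.coeff_zero_eq_eval_zero])
  have hnorm (x : ℂ) (hx : P.eval x = 0) : ‖x‖ = 1 :=
    norm_eq_one_of_root hμ hn u hdeg hP (hne x hx) hx
  have hnodup : P.roots.Nodup := by
    refine Multiset.nodup_iff_count_le_one.2 fun x => ?_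
    by_contra! hlt
    rw [Polynomial.count_roots] at hlt
    have hx : P.eval x = 0 :=
      (Polynomial.rootMultiplicity_pos hP0).1 (by omega)
    have hdvd := (Polynomial.le_rootMultiplicity_iff hP0).1 hlt
    refine not_mul_dvd_nodal hμ hn u hdeg hP (hne x hx) ?_
    -- On the circle `x` is its own mirror point, so a double root is the degenerate case of a
    -- symmetric pair.
    have : (conj x)⁻¹ = x := by
      rw [inv_eq_iff_eq_inv, Complex.inv_def, Complex.normSq_eq_norm_sq, hnorm x hx]; simp
    rw [this, ← sq]
    exact hdvd
  have hcard : P.roots.toFinset.card = n := by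
    rw [Multiset.toFinset_card_of_nodup hnodup, ← hdeg]
    exact (IsAlgClosed.splits P).natDegree_eq_card_roots.symm
  refine ⟨hnodup, ?_⟩
  have hmem (x : ℂ) : x ∈ P.roots.toFinset ↔ P.eval x = 0 := by simp [hP0]
  let e := (P.roots.toFinset.equivFinOfCardEq hcard).symm
  have he (j : Fin n) : ‖(e j : ℂ)‖ = 1 := hnorm _ ((hmem _).1 (e j).2)
  let z (j : Fin n) : Circle := ⟨e j, mem_sphere_zero_iff_norm.2 (he j)⟩
  have hz (j : Fin n) : (z j : ℂ) = e j := rfl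
  refine ⟨z, fun i j hij => ?_, fun x => ⟨fun hx => ?_, ?_⟩⟩
  · refine e.injective (Subtype.ext ?_)
    rw [← hz, ← hz, hij]
  · refine ⟨e.symm ⟨x, (hmem x).2 hx⟩, ?_⟩
    rw [hz, Equiv.apply_symm_apply]
  · rintro ⟨j, rfl⟩
    exact (hmem _).1 (e j).2

/-! ### Existence of the quadrature formula -/

/-- The Gauss quadrature argument: the weights are integrals of the Lagrange basis, and the
interpolation error of `L` vanishes at all nodes, hence is `R_n` times a cofactor whose reflection
lies in the space orthogonal to `R_n`. -/
lemma exists_weights (hμ : μ.support.Infinite) {n : ℕ} (hn : 0 < n) (u : Circle)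
    {P : Polynomial ℂ} (hdeg : P.natDegree = n)
    (hP : Polynomial.toLaurent P = nodal μ n u * T (n / 2 : ℕ)) (hnodup : P.roots.Nodup)
    {z : Fin n → Circle} (hz : Function.Injective z)
    (hroots : ∀ x : ℂ, P.eval x = 0 ↔ ∃ j, (z j : ℂ) = x) :
    ∃ lam : Fin n → ℂ, ∀ L ∈ LaurentSpan (-((n : ℤ) - 1)) ((n : ℤ) - 1),
      ∑ j, lam j * evC L (z j) = ∫ w, evC L w ∂μ := by
  have hP0 : P ≠ 0 := by rintro rfl; simp at hdeg; omega
  have hzv : Set.InjOn (fun j => (z j : ℂ)) (Finset.univ : Finset (Fin n)) :=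
    (Circle.coe_injective.comp hz).injOn
  let ℓ (j : Fin n) : Polynomial ℂ := Lagrange.basis Finset.univ (fun j => (z j : ℂ)) j
  have hℓdeg (j : Fin n) : (ℓ j).natDegree = n - 1 := by
    simpa using Lagrange.natDegree_basis hzv (Finset.mem_univ j)
  have hℓself (j : Fin n) : (ℓ j).eval (z j : ℂ) = 1 :=
    Lagrange.eval_basis_self hzv (Finset.mem_univ j)
  have hℓne {i j : Fin n} (hij : i ≠ j) : (ℓ i).eval (z j : ℂ) = 0 :=
    Lagrange.eval_basis_of_ne (v := fun j => (z j : ℂ)) hij (Finset.mem_univ j)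
  refine ⟨fun j => moment μ (Polynomial.toLaurent (ℓ j)), fun L hL => ?_⟩
  set F : Laurent := L - ∑ j, C (evC L (z j)) * Polynomial.toLaurent (ℓ j) with hF
  have hFmem : F ∈ LaurentSpan (-((n : ℤ) - 1)) ((n : ℤ) - 1) := by
    refine sub_mem hL (Submodule.sum_mem _ fun j _ => C_mul_mem ?_ _)
    exact LaurentSpan_mono (by omega) le_rfl
      (toLaurent_mem_LaurentSpan (d := n - 1) (by rw [hℓdeg]; omega))
  have hFz (j : Fin n) : evC F (z j) = 0 := by
    have hsum : evC (∑ j, C (evC L (z j)) * Polynomial.toLaurent (ℓ j)) (z j) =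
        ∑ i, evC (C (evC L (z i)) * Polynomial.toLaurent (ℓ i)) (z j) := map_sum _ _ _
    have hsub : evC F (z j) = evC L (z j) -
        evC (∑ j, C (evC L (z j)) * Polynomial.toLaurent (ℓ j)) (z j) := map_sub _ _ _
    rw [hsub, hsum, Finset.sum_eq_single j]
    · rw [evC_mul, evC_C, evC_toLaurent, hℓself, mul_one, sub_self]
    · intro i _ hij
      rw [evC_mul, evC_toLaurent, hℓne hij, mul_zero]
    · simp
  obtain ⟨G, hGdeg, hG⟩ := exists_toLaurent_eq (d := 2 * (n - 1))
    (LaurentSpan_mono (by omega) (by omega) (mul_T_mem hFmem (n - 1)))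
  have hdvd : P ∣ G := by
    by_cases hG0 : G = 0
    · rw [hG0]; exact dvd_zero _
    refine (IsAlgClosed.splits P).dvd_of_roots_le_roots hP0 ((Multiset.le_iff_subset hnodup).2 ?_)
    intro x hx
    obtain ⟨j, rfl⟩ := (hroots x).1 (Polynomial.isRoot_of_mem_roots hx)
    rw [Polynomial.mem_roots hG0, Polynomial.IsRoot, ← evC_toLaurent, hG, evC_mul, hFz, zero_mul]
  obtain ⟨Q, rfl⟩ := hdvd
  have hQmem : Polynomial.toLaurent Q ∈ LaurentSpan 0 (n - 2) := by
    by_cases hQ0 : Q = 0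
    · simp [hQ0]
    · rw [Polynomial.natDegree_mul hP0 hQ0, hdeg] at hGdeg
      exact toLaurent_mem_LaurentSpan (by omega)
  -- The double reflection only serves to present the integral of `F` as an inner product with
  -- `R_n`.
  have hFR : F = nodal μ n u *
      reflect (reflect (Polynomial.toLaurent Q * T ((n / 2 : ℕ) + 1 - n))) := by
    have e : F = F * T (n - 1) * T (1 - n) := by rw [mul_T_assoc]; simp
    rw [e, ← hG, map_mul, hP, reflect_reflect, add_sub_assoc, T_add]
    ring
  have hF0 : moment μ F = 0 := by
    rw [hFR, ← ip_eq_moment]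
    exact ip_nodal_of_mem hμ hn u
      (LaurentSpan_mono (by omega) (by omega) (reflect_mem (mul_T_mem hQmem _)))
  rw [hF, map_sub, map_sum, sub_eq_zero] at hF0
  change _ = moment μ L
  rw [hF0]
  exact Finset.sum_congr rfl fun j _ => by rw [moment_C_mul, mul_comm]

lemma exists_isSzegoQuadrature (hμ : μ.support.Infinite) {n : ℕ} (hn : 0 < n) (u : Circle) :
    ∃ (z : Fin n → Circle) (lam : Fin n → ℝ),
      (∀ j, 0 < lam j) ∧ IsSzegoQuadrature μ n u z (fun j => (lam j : ℂ)) := by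
  obtain ⟨P, hdeg, h0, hP⟩ := exists_nodal_polynomial hμ hn u
  obtain ⟨hnodup, z, hz, hroots⟩ := exists_nodes hμ hn u hdeg h0 hP
  obtain ⟨lam, hlam⟩ := exists_weights hμ hn u hdeg hP hnodup hz hroots
  let S (j : Fin n) : ℝ := ∑ i : Fin n, ‖evC (orthonormalOLP μ balanced i) (z j)‖ ^ 2
  have hS (j : Fin n) : lam j * (S j : ℂ) = 1 := weight_mul_sum_eq_one hμ hlam j
  have hSpos (j : Fin n) : 0 < S j := by
    refine lt_of_le_of_ne (Finset.sum_nonneg fun i _ => by positivity) fun h => ?_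
    have := hS j
    simp [← h] at this
  have hreal : lam = fun j => (((S j)⁻¹ : ℝ) : ℂ) := by
    funext j
    rw [Complex.ofReal_inv]
    exact eq_inv_of_mul_eq_one_left (hS j)
  refine ⟨z, fun j => (S j)⁻¹, fun j => inv_pos.2 (hSpos j), hz, fun x => ?_, ?_⟩
  · rw [ev_nodal_eq_zero_iff hP, hroots]
    simp [Units.ext_iff]
  · rwa [hreal] at hlam

end Existence

end SzegoCMV

theorem theorem5p7 (μ : MeasureTheory.Measure Circle) [MeasureTheory.IsProbabilityMeasure μ]
    (hμ : μ.support.Infinite) (n : ℕ) (hn : 0 < n) (u : Circle) :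
    -- the `n`-point Szegő quadrature formula with parameter `u` exists, with positive weights
    (∃ (z : Fin n → Circle) (lam : Fin n → ℝ),
      (∀ j, 0 < lam j) ∧ SzegoCMV.IsSzegoQuadrature μ n u z (fun j => (lam j : ℂ))) ∧
    ∀ (z : Fin n → Circle) (lam : Fin n → ℂ), SzegoCMV.IsSzegoQuadrature μ n u z lam →
      -- its nodes are the eigenvalues of the truncated CMV matrix
      (∀ x : ℂ,
        Module.End.HasEigenvalue
            (Matrix.toLin' (SzegoCMV.cmvTrunc (SzegoCMV.schur μ) n (u : ℂ))) x ↔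
          ∃ j, (z j : ℂ) = x) ∧
      -- its weights are the squared moduli of the first components of the unit eigenvectors
      (∀ (j : Fin n) (v : Fin n → ℂ),
        Module.End.HasEigenvector
            (Matrix.toLin' (SzegoCMV.cmvTrunc (SzegoCMV.schur μ) n (u : ℂ))) (z j : ℂ) v →
          ∑ i, ‖v i‖ ^ 2 = 1 →
          lam j = ((‖v ⟨0, hn⟩‖ ^ 2 : ℝ) : ℂ)) := by
  exact ⟨SzegoCMV.exists_isSzegoQuadrature hμ hn u, fun z lam h => h.eigen hμ hn⟩
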